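/- Let $d,m\ge 1$ be integers. Use $\hat f(\xi)=\int f(x)e^{-2\pi i\xi\cdot x}\,dx$ for the Fourier transform, extended to tempered distributions, and $|\xi|_1=\sum_i|\xi_i|$. For a tempered distribution $f$ on $\mathbb{R}^d$ whose Fourier transform is a function, put $$\|f\|_{\mathscr B^{1}}=\int_{\mathbb{R}^d}(1+|\xi|_1)\,|\hat f(\xi)|\,d\xi,\qquad \|f\|_{\mathscr B^{1,\log}}=\int_{\mathbb{R}^d}(1+|\xi|_1)\log_2(2+|\xi|_1)\,|\hat f(\xi)|\,d\xi,$$ and let $\mathscr B^{1,\log}$ be the space of those $f$ with $\|f\|_{\mathscr B^{1,\log}}<\infty$. A ReLU network of width $N$ and depth $L\ge 1$ is a function $F:\mathbb{R}^d\to\mathbb{R}$ of the form $F(x)=c\cdot z_L$ with $c\in\mathbb{R}^N$, $z_1=\mathrm{ReLU}(W_1x+b_1)$ and $z_l=\mathrm{ReLU}(W_lz_{l-1}+b_l)$ for $2\le l\le L$, where $W_1\in\mathbb{R}^{N\times d}$, $W_l\in\mathbb{R}^{N\times N}$ for $l\ge2$, $b_l\in\mathbb{R}^N$, and $\mathrm{ReLU}(t)=\max\{0,t\}$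 acts componentwise. Theorem. Let $f\in\mathscr B^{1,\log}$ be real-valued and nonzero, let $\Omega\subset\mathbb{R}^d$ be compact with Lebesgue measure $|\Omega|$, and let $C_2=\max\{1,\operatorname{diam}(\Omega)\}$. Then $f$ is (given by) a real-valued function, and there exists a ReLU network $F$ of width $d+4$ and depth at most $$6\,m\,C_2\log_2(2+C_2)\,\frac{\|f\|_{\mathscr B^{1,\log}}}{\|f\|_{\mathscr B^{1}}}$$ such that $$\|f-F\|_{H^1(\Omega)}\le\frac{4\pi^2}{\sqrt m}\,C_2\,|\Omega|^{1/2}\,\|f\|_{\mathscr B^1},$$ where $\|u\|_{H^1(\Omega)}^2=\int_\Omega|u|^2\,dx+\sum_{j=1}^d\int_\Omega|D_ju|^2\,dx$ and $D_j$ denotes the weak partial derivative on $\mathbb{R}^d$. -/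

import Mathlib

open MeasureTheory
open scoped SchwartzMap FourierTransform ENNReal ContDiff

namespace LogBarron

/-- `ℝᵈ` with its Euclidean norm and Lebesgue measure. -/
abbrev E (d : ℕ) : Type := EuclideanSpace ℝ (Fin d)

/-- The `1`-norm `|ξ|₁ = ∑ᵢ |ξᵢ|`. -/
noncomputable def oneNorm {d : ℕ} (ξ : E d) : ℝ := ∑ i, |ξ i|

/-- The tempered distribution `T` is (integration against) the function `g`. -/
def IsGivenBy {d : ℕ} (T : 𝓢'(E d, ℂ)) (g : E d → ℂ) : Prop :=
  LocallyIntegrable g volume ∧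
    ∀ φ : 𝓢(E d, ℂ), Integrable (fun x => φ x * g x) volume ∧ T φ = ∫ x, φ x * g x

/-- A tempered distribution is real if it takes real values on real-valued test functions. -/
def IsReal {d : ℕ} (T : 𝓢'(E d, ℂ)) : Prop :=
  ∀ φ : 𝓢(E d, ℂ), (∀ x, (φ x).im = 0) → (T φ).im = 0

/-- `∫ w(ξ) |f̂(ξ)| dξ`, where `f̂` is the Fourier transform
(convention `f̂(ξ) = ∫ f(x) e^{-2πi ξ·x} dx`) of the tempered distribution `f`.
The function `f̂` is unique up to null sets, so the infimum is over a single value;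
it is `∞` if `f̂` is not a function. -/
noncomputable def spectralNorm {d : ℕ} (w : E d → ℝ) (f : 𝓢'(E d, ℂ)) : ℝ≥0∞ :=
  ⨅ (g : E d → ℂ) (_ : IsGivenBy (𝓕 f) g), ∫⁻ ξ, ENNReal.ofReal (w ξ) * ‖g ξ‖ₑ

/-- The Barron norm `‖f‖_{B^s} = ∫ (1 + |ξ|₁^s) |f̂(ξ)| dξ`. -/
noncomputable def barronNorm {d : ℕ} (s : ℝ) (f : 𝓢'(E d, ℂ)) : ℝ≥0∞ :=
  spectralNorm (fun ξ => 1 + oneNorm ξ ^ s) f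

/-- The log-Barron norm `‖f‖_{B^{s,log}} = ∫ (1 + |ξ|₁^s) log₂(2 + |ξ|₁) |f̂(ξ)| dξ`. -/
noncomputable def logBarronNorm {d : ℕ} (s : ℝ) (f : 𝓢'(E d, ℂ)) : ℝ≥0∞ :=
  spectralNorm (fun ξ => (1 + oneNorm ξ ^ s) * Real.logb 2 (2 + oneNorm ξ)) f

/-- Membership in the log-Barron space `B^{s,log}`. -/
def MemLogBarron {d : ℕ} (s : ℝ) (f : 𝓢'(E d, ℂ)) : Prop :=
  logBarronNorm s f < ⊤

/-- Componentwise `ReLU`. -/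
def relu {N : ℕ} (z : Fin N → ℝ) : Fin N → ℝ := fun i => max 0 (z i)

/-- Hidden states: `z₁ = ReLU (A x + a)` and `z_{l+1} = ReLU (W_l z_l + b_l)`; the value at the
index `k` is `z_{k+1}`, the output of the `(k+1)`-st hidden layer. -/
def hiddenState {d N : ℕ} (A : Matrix (Fin N) (Fin d) ℝ) (a : Fin N → ℝ)
    (W : ℕ → Matrix (Fin N) (Fin N) ℝ) (b : ℕ → Fin N → ℝ) (x : E d) : ℕ → Fin N → ℝ
  | 0 => relu (A.mulVec (fun i => x i) + a)
  | k + 1 => relu ((W k).mulVec (hiddenState A a W b x k) + b k)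

/-- `F` is a `ReLU` network on `ℝᵈ` of depth `L ≥ 1` (number of hidden layers) and width `N`
(number of neurons in each hidden layer), with linear output layer `F x = c · z_L`.
Only the matrices and biases with index `< L - 1` are used. -/
def IsReLUNetwork {d : ℕ} (L N : ℕ) (F : E d → ℝ) : Prop :=
  1 ≤ L ∧ ∃ (A : Matrix (Fin N) (Fin d) ℝ) (a : Fin N → ℝ)
    (W : ℕ → Matrix (Fin N) (Fin N) ℝ) (b : ℕ → Fin N → ℝ) (c : Fin N → ℝ),
    ∀ x, F x = ∑ i, c i * hiddenState A a W b x (L - 1) i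

/-- `v` is the weak partial derivative `D_j u` on `ℝᵈ`. -/
def HasWeakPartialDeriv {d : ℕ} (j : Fin d) (u v : E d → ℝ) : Prop :=
  LocallyIntegrable u volume ∧ LocallyIntegrable v volume ∧
    ∀ φ : E d → ℝ, ContDiff ℝ ∞ φ → HasCompactSupport φ →
      ∫ x, u x * fderiv ℝ φ x (EuclideanSpace.single j 1) = -∫ x, v x * φ x

/-- `‖u‖_{H¹(Ω)} = (‖u‖²_{L²(Ω)} + ∑ⱼ ‖D_j u‖²_{L²(Ω)})^{1/2}` for a function `u` on `ℝᵈ`.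
Weak derivatives are unique up to null sets, so the infimum is over a single value;
it is `∞` if `u` is not weakly differentiable. -/
noncomputable def h1Norm {d : ℕ} (Ω : Set (E d)) (u : E d → ℝ) : ℝ≥0∞ :=
  ⨅ (v : Fin d → E d → ℝ) (_ : ∀ j, HasWeakPartialDeriv j u (v j)),
    ((∫⁻ x in Ω, ‖u x‖ₑ ^ 2) + ∑ j, ∫⁻ x in Ω, ‖v j x‖ₑ ^ 2) ^ (1 / 2 : ℝ)

/-- `C₂(Ω) = max {1, diam Ω}`. -/
noncomputable def C₂ {d : ℕ} (Ω : Set (E d)) : ℝ := max 1 (Metric.diam Ω)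

end LogBarron

open LogBarron

/-! Write `g` for the Fourier transform of `f`, and `B` for the integral of (1 + |ξ|₁)|g(ξ)|. Since
`g` is integrable and `f` is real, Fourier inversion gives f(x) = ∫ |g(ξ)| cos(2π(ξ·x + phase)) dξ
(`isGivenBy_fourierInv`, `re_fourierInv`).

Let T be the triangle wave. Then cos(2πt) = cos(πT(t)), and Taylor's formula with integral remainder
for the cosine on [0, 1] gives cos(2πt) = ∫₀¹ (1 - π² cos(πr) ReLU(T(t) - r)) dr. Hence f is the
expectation of the ridge functions `atom`, where ξ has density (1 + |ξ|₁)|g(ξ)|/B and r is uniform.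
The weight B/(1 + |ξ|₁) bounds an atom together with its gradient by 2π²B, so the mean of m samples
has expected squared H¹(Ω) error at most 4π⁴B²|Ω|/m.

A network reproduces the sampled sum exactly near Ω. Composing with the tent map doubles the
argument of T, so one atom takes a number of layers logarithmic in |ξ|₁ and in the size of Ω
(`exists_layers_foldedRelu`). Atoms are computed one after another; the width d + 4 consists of the
d inputs, a constant, the partial sum and two working neurons. The expectation of log₂(2 + |ξ|₁)
under the sampling law is exactly the ratio of the log-Barron norm to the Barron norm.

Finally `exists_sample` finds one sample whose squared error is at most 4 times, and whose depth
cost is at most 4/3 times, the corresponding mean bound; this is possible because 1/4 + 3/4 = 1. The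
factor 4 turns 2π² into 4π² after the square root, and 9/2 · 4/3 = 6 is the depth constant. -/

namespace LogBarron

/-! ### The triangle wave -/

/-- The triangle wave of period `1` with values in `[0, 1]` that vanishes at the integers. -/
noncomputable def triangleWave (t : ℝ) : ℝ := Real.arccos (Real.cos (2 * Real.pi * t)) / Real.pi

theorem continuous_triangleWave : Continuous triangleWave := by
  unfold triangleWave
  exact (Real.continuous_arccos.comp (by fun_prop)).div_const _

theorem triangleWave_nonneg (t : ℝ) : 0 ≤ triangleWave t :=
  div_nonneg (Real.arccos_nonneg _) Real.pi_pos.le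

theorem triangleWave_le_one (t : ℝ) : triangleWave t ≤ 1 :=
  (div_le_one Real.pi_pos).2 (Real.arccos_le_pi _)

theorem pi_mul_triangleWave (t : ℝ) :
    Real.pi * triangleWave t = Real.arccos (Real.cos (2 * Real.pi * t)) :=
  mul_div_cancel₀ _ Real.pi_pos.ne'

theorem cos_pi_mul_triangleWave (t : ℝ) :
    Real.cos (Real.pi * triangleWave t) = Real.cos (2 * Real.pi * t) := by
  rw [pi_mul_triangleWave, Real.cos_arccos (Real.neg_one_le_cos _) (Real.cos_le_one _)]

theorem sin_pi_mul_triangleWave (t : ℝ) :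
    Real.sin (Real.pi * triangleWave t) = |Real.sin (2 * Real.pi * t)| := by
  rw [pi_mul_triangleWave, Real.sin_arccos, Real.abs_sin_eq_sqrt_one_sub_cos_sq]

theorem triangleWave_eq_of_cos_eq {s t : ℝ} (h0 : 0 ≤ s) (h1 : s ≤ 1)
    (h : Real.cos (2 * Real.pi * t) = Real.cos (Real.pi * s)) : triangleWave t = s := by
  have := Real.pi_pos
  rw [triangleWave, h, Real.arccos_cos (by positivity) (by nlinarith), mul_div_cancel_left₀ _ this.ne']

theorem triangleWave_half {s : ℝ} (h0 : 0 ≤ s) (h1 : s ≤ 1) : triangleWave (s / 2) = s :=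
  triangleWave_eq_of_cos_eq h0 h1 (by ring_nf)

theorem triangleWave_sub_intCast (t : ℝ) (n : ℤ) : triangleWave (t - n) = triangleWave t := by
  rw [triangleWave, triangleWave, ← Real.cos_sub_int_mul_two_pi (2 * Real.pi * t) n]
  ring_nf

/-- Doubling the argument applies the tent map to the value, and the tent map on [0, 1] is a
combination of two ReLUs. One layer thus doubles the frequency. -/
theorem triangleWave_two_mul (t : ℝ) :
    triangleWave (2 * t) =
      2 * max 0 (triangleWave t) - 4 * max 0 (triangleWave t - 1 / 2) := by
  have h0 := triangleWave_nonneg t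
  have h1 := triangleWave_le_one t
  have hc : Real.cos (2 * Real.pi * (2 * t)) = Real.cos (2 * (Real.pi * triangleWave t)) := by
    rw [Real.cos_two_mul, cos_pi_mul_triangleWave, ← Real.cos_two_mul]; ring_nf
  rw [max_eq_right h0]
  rcases le_total (triangleWave t) (1 / 2) with h | h
  · rw [max_eq_left (by linarith)]
    refine triangleWave_eq_of_cos_eq (by linarith) (by linarith) ?_
    rw [hc]; ring_nf
  · rw [max_eq_right (by linarith)]
    refine triangleWave_eq_of_cos_eq (by linarith) (by linarith) ?_
    rw [hc, ← Real.cos_neg, ← Real.cos_add_two_pi]; ring_nf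

/-- The derivative of the triangle wave off the half-integers. -/
noncomputable def triangleSlope (t : ℝ) : ℝ := 2 * SignType.sign (Real.sin (2 * Real.pi * t))

theorem abs_triangleSlope_le (t : ℝ) : |triangleSlope t| ≤ 2 := by
  unfold triangleSlope
  rcases SignType.sign (Real.sin (2 * Real.pi * t)) <;> simp

theorem measurable_triangleSlope : Measurable triangleSlope := by
  have : triangleSlope = fun t => if 0 < Real.sin (2 * Real.pi * t) then (2 : ℝ) else
      if Real.sin (2 * Real.pi * t) < 0 then -2 else 0 := by
    ext t
    simp only [triangleSlope, sign_apply]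
    split_ifs <;> simp
  rw [this]
  refine Measurable.ite (measurableSet_lt (by fun_prop) (by fun_prop)) (by fun_prop)
    (Measurable.ite (measurableSet_lt (by fun_prop) (by fun_prop)) (by fun_prop) (by fun_prop))

theorem hasDerivAt_triangleWave {t : ℝ} (ht : Real.sin (2 * Real.pi * t) ≠ 0) :
    HasDerivAt triangleWave (triangleSlope t) t := by
  have hc := Real.sin_sq_add_cos_sq (2 * Real.pi * t)
  have hpos : 0 < Real.sin (2 * Real.pi * t) ^ 2 := by positivity
  have h1 : Real.cos (2 * Real.pi * t) ≠ -1 := by intro h; rw [h] at hc; linarith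
  have h2 : Real.cos (2 * Real.pi * t) ≠ 1 := by intro h; rw [h] at hc; linarith
  have hin : HasDerivAt (fun t : ℝ => 2 * Real.pi * t) (2 * Real.pi) t := by
    simpa using (hasDerivAt_id t).const_mul (2 * Real.pi)
  have := ((Real.hasDerivAt_arccos h1 h2).comp t hin.cos).div_const Real.pi
  refine this.congr_deriv ?_
  rw [← Real.abs_sin_eq_sqrt_one_sub_cos_sq, triangleSlope]
  have hpi := Real.pi_pos.ne'
  rcases lt_or_gt_of_ne ht with h | h
  · rw [abs_of_neg h, sign_neg h]; field_simp; simp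
  · rw [abs_of_pos h, sign_pos h]; field_simp; simp

theorem countable_setOf_cos_eq (c : ℝ) : {t : ℝ | Real.cos (2 * Real.pi * t) = c}.Countable := by
  by_cases hc : ∃ s, Real.cos s = c
  · obtain ⟨s, rfl⟩ := hc
    refine ((Set.countable_range fun k : ℤ => (2 * k * Real.pi + s) / (2 * Real.pi)).union
      (Set.countable_range fun k : ℤ => (2 * k * Real.pi - s) / (2 * Real.pi))).mono ?_
    intro t ht
    have hpi := Real.pi_pos.ne'
    obtain ⟨k, hk | hk⟩ := Real.cos_eq_cos_iff.1 (Eq.symm ht)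
    · left; exact ⟨k, by simp only; rw [← hk]; field_simp⟩
    · right; exact ⟨k, by simp only; rw [← hk]; field_simp⟩
  · convert Set.countable_empty
    ext t
    simp only [Set.mem_ofPred_eq, Set.mem_empty_iff_false, iff_false]
    exact fun h => hc ⟨_, h⟩

/-! ### The cosine as a superposition of folded ReLUs -/

/-- The ridge profile `t ↦ ReLU (triangleWave t - r)`. -/
noncomputable def foldedRelu (r t : ℝ) : ℝ := max 0 (triangleWave t - r)

/-- The derivative of `foldedRelu r` off a countable set. -/
noncomputable def foldedSlope (r t : ℝ) : ℝ := if r < triangleWave t then triangleSlope t else 0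

theorem foldedRelu_nonneg (r t : ℝ) : 0 ≤ foldedRelu r t := le_max_left _ _

theorem foldedRelu_le_one {r : ℝ} (hr : 0 ≤ r) (t : ℝ) : foldedRelu r t ≤ 1 :=
  max_le zero_le_one (by linarith [triangleWave_le_one t])

theorem abs_foldedSlope_le (r t : ℝ) : |foldedSlope r t| ≤ 2 := by
  unfold foldedSlope
  split_ifs
  · exact abs_triangleSlope_le t
  · simp

theorem exists_countable_hasDerivAt_foldedRelu (r : ℝ) :
    ∃ s : Set ℝ, s.Countable ∧ ∀ t ∉ s, HasDerivAt (foldedRelu r) (foldedSlope r t) t := by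
  -- The kinks lie where the wave meets the level `r` or at half-integers; each condition fixes the
  -- value of cos(2πt).
  refine ⟨{t | Real.cos (2 * Real.pi * t) = Real.cos (Real.pi * r)} ∪
    ({t | Real.cos (2 * Real.pi * t) = 1} ∪ {t | Real.cos (2 * Real.pi * t) = -1}),
    (countable_setOf_cos_eq _).union ((countable_setOf_cos_eq _).union (countable_setOf_cos_eq _)),
    fun t ht => ?_⟩
  simp only [Set.mem_union, Set.mem_ofPred_eq, not_or] at ht
  obtain ⟨h1, h2, h3⟩ := ht
  have hs : Real.sin (2 * Real.pi * t) ≠ 0 := by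
    intro h
    have := Real.sin_sq_add_cos_sq (2 * Real.pi * t)
    rw [h] at this
    have hsq : (Real.cos (2 * Real.pi * t) - 1) * (Real.cos (2 * Real.pi * t) + 1) = 0 := by
      linarith
    rcases mul_eq_zero.1 hsq with h | h
    exacts [h2 (by linarith), h3 (by linarith)]
  have hd := hasDerivAt_triangleWave hs
  have hne : triangleWave t ≠ r := fun h => h1 (by rw [← h, cos_pi_mul_triangleWave])
  rcases lt_or_gt_of_ne hne with h | h
  · rw [foldedSlope, if_neg h.not_gt]
    refine (hasDerivAt_const t (0 : ℝ)).congr_of_eventuallyEq ?_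
    filter_upwards [continuous_triangleWave.continuousAt.eventually_lt_const h] with y hy
    exact max_eq_left (by linarith)
  · rw [foldedSlope, if_pos h]
    refine (hd.sub_const r).congr_of_eventuallyEq ?_
    filter_upwards [continuous_triangleWave.continuousAt.eventually_const_lt h] with y hy
    exact max_eq_right (by linarith)

/-- This is Taylor's formula at 0 with integral remainder for 1 - cos(πs), whose value and first
derivative vanish there; the ReLU cuts the range of integration at s. -/
theorem integral_cos_mul_relu {s : ℝ} (h0 : 0 ≤ s) (h1 : s ≤ 1) :
    ∫ r in (0 : ℝ)..1, Real.pi ^ 2 * Real.cos (Real.pi * r) * max 0 (s - r) =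
      1 - Real.cos (Real.pi * s) := by
  have hpi := Real.pi_pos.ne'
  have hcont : Continuous fun r : ℝ => Real.pi ^ 2 * Real.cos (Real.pi * r) * max 0 (s - r) := by
    fun_prop
  rw [← intervalIntegral.integral_add_adjacent_intervals (hcont.intervalIntegrable 0 s)
    (hcont.intervalIntegrable s 1)]
  have e2 : ∫ r in s..1, Real.pi ^ 2 * Real.cos (Real.pi * r) * max 0 (s - r) = 0 := by
    rw [intervalIntegral.integral_congr (g := fun _ => 0), intervalIntegral.integral_zero]
    intro r hr
    rw [Set.uIcc_of_le h1] at hr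
    simp [max_eq_left (sub_nonpos.2 hr.1)]
  have e1 : ∫ r in (0 : ℝ)..s, Real.pi ^ 2 * Real.cos (Real.pi * r) * max 0 (s - r) =
      ∫ r in (0 : ℝ)..s, Real.pi ^ 2 * Real.cos (Real.pi * r) * (s - r) := by
    refine intervalIntegral.integral_congr fun r hr => ?_
    rw [Set.uIcc_of_le h0] at hr
    simp [max_eq_right (sub_nonneg.2 hr.2)]
  rw [e1, e2, add_zero, intervalIntegral.integral_eq_sub_of_hasDerivAt
    (f := fun r => Real.pi * (s - r) * Real.sin (Real.pi * r) - Real.cos (Real.pi * r))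
    (fun r _ => ?_) (Continuous.intervalIntegrable (by fun_prop) _ _)]
  · simp; ring
  · have hin : HasDerivAt (fun r : ℝ => Real.pi * r) Real.pi r := by
      simpa using (hasDerivAt_id r).const_mul Real.pi
    have hl : HasDerivAt (fun r : ℝ => Real.pi * (s - r)) (-Real.pi) r := by
      simpa using ((hasDerivAt_id r).const_sub s).const_mul Real.pi
    refine ((hl.mul hin.sin).sub hin.cos).congr_deriv ?_
    ring

theorem integral_cos_indicator {s : ℝ} (h0 : 0 ≤ s) (h1 : s ≤ 1) :
    ∫ r in (0 : ℝ)..1, (if r < s then Real.pi ^ 2 * Real.cos (Real.pi * r) else 0) =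
      Real.pi * Real.sin (Real.pi * s) := by
  have hcont : Continuous fun r : ℝ => Real.pi ^ 2 * Real.cos (Real.pi * r) := by fun_prop
  have : ∫ r in (0 : ℝ)..1, (if r < s then Real.pi ^ 2 * Real.cos (Real.pi * r) else 0) =
      ∫ r in (0 : ℝ)..s, Real.pi ^ 2 * Real.cos (Real.pi * r) := by
    rw [intervalIntegral.integral_of_le zero_le_one, intervalIntegral.integral_of_le h0,
      integral_Ioc_eq_integral_Ioo (x := 0) (y := s),
      ← integral_indicator measurableSet_Ioc, ← integral_indicator measurableSet_Ioo]
    congr 1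
    ext r
    simp only [Set.indicator, Set.mem_Ioc, Set.mem_Ioo]
    split_ifs <;> first | rfl | (exfalso; grind)
  rw [this, intervalIntegral.integral_eq_sub_of_hasDerivAt
    (f := fun r => Real.pi * Real.sin (Real.pi * r))
    (fun r _ => ?_) (hcont.intervalIntegrable _ _)]
  · simp
  · have hin : HasDerivAt (fun r : ℝ => Real.pi * r) Real.pi r := by
      simpa using (hasDerivAt_id r).const_mul Real.pi
    refine (hin.sin.const_mul Real.pi).congr_deriv ?_
    ring

theorem integral_one_sub_foldedRelu (t : ℝ) :
    ∫ r in (0 : ℝ)..1, (1 - Real.pi ^ 2 * Real.cos (Real.pi * r) * foldedRelu r t) =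
      Real.cos (2 * Real.pi * t) := by
  unfold foldedRelu
  rw [intervalIntegral.integral_sub (by simp) (Continuous.intervalIntegrable (by fun_prop) _ _),
    integral_cos_mul_relu (triangleWave_nonneg t) (triangleWave_le_one t),
    cos_pi_mul_triangleWave]
  simp

theorem integral_foldedSlope (t : ℝ) :
    ∫ r in (0 : ℝ)..1, Real.pi ^ 2 * Real.cos (Real.pi * r) * foldedSlope r t =
      2 * Real.pi * Real.sin (2 * Real.pi * t) := by
  have : ∀ r : ℝ, Real.pi ^ 2 * Real.cos (Real.pi * r) * foldedSlope r t =
      (if r < triangleWave t then Real.pi ^ 2 * Real.cos (Real.pi * r) else 0) *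
        triangleSlope t := by
    intro r; unfold foldedSlope; split_ifs <;> simp
  simp_rw [this]
  rw [intervalIntegral.integral_mul_const,
    integral_cos_indicator (triangleWave_nonneg t) (triangleWave_le_one t),
    sin_pi_mul_triangleWave, triangleSlope]
  -- Since sign 0 = 0, the identity also holds at the kinks of the wave, so no exceptional set of
  -- `t` is needed.
  have := abs_mul_sign (Real.sin (2 * Real.pi * t))
  linear_combination (2 * Real.pi) * this

end LogBarron

namespace LogBarron

/-! ### Networks that carry their input -/

variable {d N : ℕ}

theorem hiddenState_congr {A : Matrix (Fin N) (Fin d) ℝ} {a : Fin N → ℝ}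
    {W W' : ℕ → Matrix (Fin N) (Fin N) ℝ} {b b' : ℕ → Fin N → ℝ} (x : E d) {k : ℕ}
    (hW : ∀ j < k, W j = W' j) (hb : ∀ j < k, b j = b' j) :
    hiddenState A a W b x k = hiddenState A a W' b' x k := by
  induction k with
  | zero => rfl
  | succ k ih =>
    simp only [hiddenState]
    rw [ih (fun j hj => hW j (by omega)) (fun j hj => hb j (by omega)), hW k (by omega),
      hb k (by omega)]

/-- The functions that agree on `S` with a linear readout of the state `z`. -/
def readout (S : Set (E d)) (z : E d → Fin N → ℝ) : Submodule ℝ (E d → ℝ) where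
  carrier := {h | ∃ c : Fin N → ℝ, ∀ x ∈ S, h x = ∑ i, c i * z x i}
  add_mem' := by
    rintro f g ⟨c, hc⟩ ⟨e, he⟩
    exact ⟨c + e, fun x hx => by simp [hc x hx, he x hx, add_mul, Finset.sum_add_distrib]⟩
  zero_mem' := ⟨0, fun x _ => by simp⟩
  smul_mem' := by
    rintro t f ⟨c, hc⟩
    exact ⟨t • c, fun x hx => by simp [hc x hx, Finset.mul_sum, mul_assoc]⟩

/-- The functions that agree on `S` with an affine function of the input. -/
def affineOn (S : Set (E d)) : Submodule ℝ (E d → ℝ) where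
  carrier := {h | ∃ (w : Fin d → ℝ) (β : ℝ), ∀ x ∈ S, h x = ∑ i, w i * x i + β}
  add_mem' := by
    rintro f g ⟨c, β, hc⟩ ⟨e, γ, he⟩
    refine ⟨c + e, β + γ, fun x hx => ?_⟩
    simp [hc x hx, he x hx, add_mul, Finset.sum_add_distrib]
    ring
  zero_mem' := ⟨0, 0, fun x _ => by simp⟩
  smul_mem' := by
    rintro t f ⟨c, β, hc⟩
    exact ⟨t • c, t * β, fun x hx => by simp [hc x hx, Finset.mul_sum, mul_assoc, mul_add]⟩

theorem mem_readout {S : Set (E d)} {z : E d → Fin N → ℝ} {h : E d → ℝ} (i : Fin N)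
    (hi : ∀ x ∈ S, h x = z x i) : h ∈ readout S z :=
  ⟨Pi.single i 1, fun x hx => by simp [hi x hx, Pi.single_apply]⟩

theorem readout_mono {S : Set (E d)} {z z' : E d → Fin N → ℝ} (h : ∀ x ∈ S, z x = z' x) :
    readout S z ≤ readout S z' := by
  rintro f ⟨c, hc⟩
  exact ⟨c, fun x hx => by rw [hc x hx, h x hx]⟩

/-- On `S`, every function in `Φ` is a readout of some network with `n` hidden layers (an affine
function of the input if `n = 0`); the network is the same for all of `Φ`. -/
def Computes (N : ℕ) (S : Set (E d)) : ℕ → Submodule ℝ (E d → ℝ) → Prop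
  | 0, Φ => Φ ≤ affineOn S
  | k + 1, Φ => ∃ (A : Matrix (Fin N) (Fin d) ℝ) (a : Fin N → ℝ)
      (W : ℕ → Matrix (Fin N) (Fin N) ℝ) (b : ℕ → Fin N → ℝ),
      Φ ≤ readout S (fun x => hiddenState A a W b x k)

/-- The arguments of the new ReLUs are linear in the previous state (affine in the input when `n =
0`), so their readout coefficients become the rows of the next weight matrix. -/
theorem Computes.layer {S : Set (E d)} {n : ℕ} {Φ : Submodule ℝ (E d → ℝ)}
    (h : Computes N S n Φ) (p : Fin N → E d → ℝ) (hp : ∀ i, p i ∈ Φ) :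
    Computes N S (n + 1) (readout S fun x i => max 0 (p i x)) := by
  cases n with
  | zero =>
    choose w β hw using fun i => h (hp i)
    refine ⟨Matrix.of w, β, 0, 0, readout_mono fun x hx => ?_⟩
    ext i
    simp [hiddenState, relu, Matrix.mulVec, dotProduct, hw i x hx]
  | succ k =>
    obtain ⟨A, a, W, b, hΦ⟩ := h
    choose c hc using fun i => hΦ (hp i)
    -- The state at index `k` uses only weights of index below `k`, so overwriting index `k` leaves
    -- it intact.
    refine ⟨A, a, Function.update W k (Matrix.of c), Function.update b k 0,
      readout_mono fun x hx => ?_⟩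
    have : hiddenState A a (Function.update W k (Matrix.of c)) (Function.update b k 0) x k =
        hiddenState A a W b x k :=
      hiddenState_congr x (fun j hj => Function.update_of_ne hj.ne _ _)
        (fun j hj => Function.update_of_ne hj.ne _ _)
    ext i
    simp [hiddenState, relu, Matrix.mulVec, dotProduct, hc i x hx, this]

/-- A network of width `d + 4` from whose last layer the input and the constants can be read. -/
structure Carries (S : Set (E d)) (n : ℕ) (Φ : Submodule ℝ (E d → ℝ)) : Prop where
  computes : Computes (d + 4) S n Φ
  one_mem : (fun _ => 1) ∈ Φ
  coord_mem : ∀ i, (fun x : E d => x i) ∈ Φ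
  mem_congr : ∀ f ∈ Φ, ∀ g : E d → ℝ, (∀ x ∈ S, g x = f x) → g ∈ Φ

theorem Carries.const_mem {S : Set (E d)} {n : ℕ} {Φ : Submodule ℝ (E d → ℝ)}
    (h : Carries S n Φ) (c : ℝ) : (fun _ => c) ∈ Φ := by
  convert Φ.smul_mem c h.one_mem using 1
  ext; simp

theorem Carries.affine_mem {S : Set (E d)} {n : ℕ} {Φ : Submodule ℝ (E d → ℝ)}
    (h : Carries S n Φ) (ξ : E d) (c : ℝ) : (fun x => inner ℝ ξ x + c) ∈ Φ := by
  convert Φ.add_mem (Φ.sum_mem fun i (_ : i ∈ Finset.univ) => Φ.smul_mem (ξ i) (h.coord_mem i))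
    (h.const_mem c) using 1
  ext x
  simp [PiLp.inner_apply, mul_comm]

theorem carries_zero (S : Set (E d)) : Carries S 0 (affineOn S) where
  computes := le_rfl
  one_mem := ⟨0, 1, fun x _ => by simp⟩
  coord_mem i := ⟨Pi.single i 1, 0, fun x _ => by simp [Pi.single_apply]⟩
  mem_congr := by
    rintro f ⟨w, β, hw⟩ g hg
    exact ⟨w, β, fun x hx => by rw [hg x hx, hw x hx]⟩

/-- One more layer: carry the input, a bounded function `h` and the constants, and apply `ReLU` to
two further functions. -/
theorem Carries.layer {S : Set (E d)} {n : ℕ} {Φ : Submodule ℝ (E d → ℝ)} (hΦ : Carries S n Φ)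
    {ρ K : ℝ} (hρ : ∀ x ∈ S, ∀ i, |x i| ≤ ρ) {h p q : E d → ℝ} (hK : ∀ x ∈ S, |h x| ≤ K)
    (hh : h ∈ Φ) (hp : p ∈ Φ) (hq : q ∈ Φ) :
    ∃ Φ', Carries S (n + 1) Φ' ∧ h ∈ Φ' ∧ (fun x => max 0 (p x)) ∈ Φ' ∧
      (fun x => max 0 (q x)) ∈ Φ' := by
  -- The shifts by `ρ` and `K` make the carried channels nonnegative on `S`, where ReLU is then the
  -- identity; the constant channel allows the shifts to be undone.
  let P : Fin (d + 4) → E d → ℝ :=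
    Fin.append (fun i x => x i + ρ) ![fun _ => 1, fun x => h x + K, p, q]
  have hP : ∀ i, P i ∈ Φ := by
    intro i
    refine Fin.addCases (fun j => ?_) (fun j => ?_) i
    · simp only [P, Fin.append_left]
      exact Φ.add_mem (hΦ.coord_mem j) (hΦ.const_mem ρ)
    · simp only [P, Fin.append_right]
      fin_cases j
      · exact hΦ.one_mem
      · exact Φ.add_mem hh (hΦ.const_mem K)
      · exact hp
      · exact hq
  have key : ∀ (j : Fin 4), (fun x => max 0 (P (Fin.natAdd d j) x)) ∈
      readout S fun x i => max 0 (P i x) := fun j => mem_readout (Fin.natAdd d j) fun _ _ => rfl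
  simp only [P, Fin.append_right] at key
  have hone : (fun _ => 1) ∈ readout S fun x i => max 0 (P i x) := by
    simpa using key 0
  have hconst : ∀ c : ℝ, (fun _ => c) ∈ readout S fun x i => max 0 (P i x) := fun c => by
    convert (readout S fun x i => max 0 (P i x)).smul_mem c hone using 1
    ext; simp
  refine ⟨_, ⟨hΦ.computes.layer P hP, hone, fun i => ?_, ?_⟩, ?_, key 2, key 3⟩
  · have : (fun x : E d => x i + ρ) ∈ readout S fun x i => max 0 (P i x) := by
      refine mem_readout (Fin.castAdd 4 i) fun x hx => ?_
      simp only [P, Fin.append_left]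
      rw [max_eq_right]
      linarith [neg_abs_le (x i), hρ x hx i]
    convert Submodule.sub_mem _ this (hconst ρ) using 1
    ext; simp
  · rintro f ⟨c, hc⟩ g hg
    exact ⟨c, fun x hx => by rw [hg x hx, hc x hx]⟩
  · have : (fun x => h x + K) ∈ readout S fun x i => max 0 (P i x) := by
      refine mem_readout (Fin.natAdd d 1) fun x hx => ?_
      simp only [P, Fin.append_right]
      simp only [Matrix.cons_val_one, Matrix.cons_val_zero]
      rw [max_eq_right]
      linarith [neg_abs_le (h x), hK x hx]
    convert Submodule.sub_mem _ this (hconst K) using 1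
    ext; simp

theorem Carries.triangleWave_pow {S : Set (E d)} {n : ℕ} {Φ : Submodule ℝ (E d → ℝ)}
    (hΦ : Carries S n Φ) {ρ K : ℝ} (hρ : ∀ x ∈ S, ∀ i, |x i| ≤ ρ) {h τ : E d → ℝ}
    (hK : ∀ x ∈ S, |h x| ≤ K) (hh : h ∈ Φ) (hτ : (fun x => triangleWave (τ x)) ∈ Φ) (k : ℕ) :
    ∃ Φ', Carries S (n + k) Φ' ∧ h ∈ Φ' ∧ (fun x => triangleWave (2 ^ k * τ x)) ∈ Φ' := by
  induction k with
  | zero => exact ⟨Φ, hΦ, hh, by simpa using hτ⟩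
  | succ k ih =>
    obtain ⟨Ψ, hΨ, hhΨ, hs⟩ := ih
    obtain ⟨Φ', h1, h2, h3, h4⟩ := hΨ.layer hρ hK hhΨ hs
      (Ψ.sub_mem hs (hΨ.const_mem (1 / 2)))
    refine ⟨Φ', h1, h2, ?_⟩
    convert Φ'.sub_mem (Φ'.smul_mem 2 h3) (Φ'.smul_mem 4 h4) using 1
    ext x
    rw [pow_succ', mul_assoc, triangleWave_two_mul]
    simp

/-! ### Counting layers -/

theorem exists_two_pow_ge {y : ℝ} (hy : 1 ≤ y) :
    ∃ j : ℕ, y ≤ 2 ^ j ∧ (j : ℝ) ≤ Real.logb 2 y + 1 := by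
  obtain ⟨n, h1, h2⟩ := exists_nat_pow_near hy (one_lt_two : (1 : ℝ) < 2)
  refine ⟨n + 1, h2.le, ?_⟩
  have : (n : ℝ) ≤ Real.logb 2 y := by
    rw [Real.le_logb_iff_rpow_le one_lt_two (by linarith)]
    simpa using h1
  push_cast
  linarith

theorem abs_inner_le_oneNorm_mul_norm (ξ x : E d) : |inner ℝ ξ x| ≤ oneNorm ξ * ‖x‖ := by
  rw [PiLp.inner_apply, oneNorm, Finset.sum_mul]
  refine (Finset.abs_sum_le_sum_abs _ _).trans (Finset.sum_le_sum fun i _ => ?_)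
  simp only [RCLike.inner_apply, conj_trivial, abs_mul]
  rw [mul_comm]
  exact mul_le_mul_of_nonneg_left (PiLp.norm_apply_le x i) (abs_nonneg _)

theorem oneNorm_nonneg (ξ : E d) : 0 ≤ oneNorm ξ := Finset.sum_nonneg fun _ _ => abs_nonneg _

theorem one_le_logb_two_add_oneNorm (ξ : E d) : 1 ≤ Real.logb 2 (2 + oneNorm ξ) := by
  rw [Real.le_logb_iff_rpow_le one_lt_two (by linarith [oneNorm_nonneg ξ])]
  simpa using oneNorm_nonneg ξ

/-- This is 2^(3/2) ≤ 3, that is, 8 ≤ 9. -/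
theorem three_halves_le_logb {C : ℝ} (hC : 1 ≤ C) : 3 / 2 ≤ Real.logb 2 (2 + C) := by
  rw [Real.le_logb_iff_rpow_le one_lt_two (by linarith)]
  have h8 : ((2 : ℝ) ^ (3 / 2 : ℝ)) ^ 2 = 8 := by
    rw [← Real.rpow_natCast, ← Real.rpow_mul (by norm_num)]; norm_num
  have : (0 : ℝ) < 2 ^ (3 / 2 : ℝ) := by positivity
  nlinarith

/-- The cost in layers of one ridge function `x ↦ ReLU (triangleWave (ξ · x + θ) - r)`. -/
theorem exists_layers_foldedRelu {C : ℝ} (hC : 1 ≤ C) (x₀ ξ : E d) (θ : ℝ) :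
    ∃ k : ℕ, 1 ≤ k ∧
      (k : ℝ) ≤ 9 / 2 * (Real.logb 2 (2 + C) * Real.logb 2 (2 + oneNorm ξ)) ∧
      ∀ (n : ℕ) (Φ : Submodule ℝ (E d → ℝ)) (h : E d → ℝ) (K r : ℝ),
        Carries (Metric.ball x₀ (C + 1)) n Φ → (∀ x ∈ Metric.ball x₀ (C + 1), |h x| ≤ K) → h ∈ Φ →
        ∃ Φ', Carries (Metric.ball x₀ (C + 1)) (n + k) Φ' ∧ h ∈ Φ' ∧
          (fun x => foldedRelu r (inner ℝ ξ x + θ)) ∈ Φ' := by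
  have hξ := oneNorm_nonneg ξ
  obtain ⟨j, hj, hjl⟩ := exists_two_pow_ge
    (y := 2 * (oneNorm ξ * (C + 1)) + 1) (by nlinarith [mul_nonneg hξ (by linarith : 0 ≤ C + 1)])
  -- There are `j + 1` doublings and one final ReLU layer. With a, b the two logarithms, j + 2 ≤ 4 +
  -- a + b, and (a - 3/2)(b - 1) ≥ 0 bounds this by 9/2 · ab.
  refine ⟨j + 2, by omega, ?_, fun n Φ h K r hΦ hK hh => ?_⟩
  · have ha := three_halves_le_logb hC
    have hb := one_le_logb_two_add_oneNorm ξ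
    have hle : Real.logb 2 (2 * (oneNorm ξ * (C + 1)) + 1) ≤
        1 + Real.logb 2 (2 + C) + Real.logb 2 (2 + oneNorm ξ) := by
      have h2 : Real.logb 2 2 = 1 := Real.logb_self_eq_one one_lt_two
      conv_rhs => rw [← h2]
      rw [← Real.logb_mul (by norm_num) (by linarith),
        ← Real.logb_mul (by nlinarith) (by linarith)]
      refine Real.logb_le_logb_of_le one_lt_two (by positivity) ?_
      nlinarith
    push_cast
    nlinarith [mul_nonneg (sub_nonneg.2 ha) (sub_nonneg.2 hb)]
  · set S := Metric.ball x₀ (C + 1) with hS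
    have hρ : ∀ x ∈ S, ∀ i, |x i| ≤ ‖x₀‖ + (C + 1) := by
      intro x hx i
      have h1 := PiLp.norm_apply_le x i
      rw [hS, mem_ball_iff_norm] at hx
      have h2 := norm_sub_norm_le x x₀
      rw [Real.norm_eq_abs] at h1
      linarith
    -- An integer shift is invisible to the wave and places ξ·x + θ - t₀ in [0, 2^j] on the ball.
    -- Hence `τ` takes values in [0, 1/2], where the wave is linear and needs no layer.
    set t₀ : ℤ := ⌊inner ℝ ξ x₀ + θ - oneNorm ξ * (C + 1)⌋ with ht₀
    set τ : E d → ℝ := fun x => (inner ℝ ξ x + θ - t₀) / 2 ^ j / 2 with hτ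
    have hmem : (fun x => triangleWave (τ x)) ∈ Φ := by
      refine hΦ.mem_congr _ (Φ.smul_mem ((2 : ℝ) ^ j)⁻¹ (hΦ.affine_mem ξ (θ - t₀))) _ fun x hx => ?_
      have h1 : |inner ℝ ξ (x - x₀)| ≤ oneNorm ξ * (C + 1) :=
        (abs_inner_le_oneNorm_mul_norm ξ _).trans (mul_le_mul_of_nonneg_left
          (mem_ball_iff_norm.1 hx).le hξ)
      rw [inner_sub_right, abs_le] at h1
      have h2 := Int.floor_le (inner ℝ ξ x₀ + θ - oneNorm ξ * (C + 1))
      have h3 := Int.lt_floor_add_one (inner ℝ ξ x₀ + θ - oneNorm ξ * (C + 1))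
      rw [← ht₀] at h2 h3
      rw [hτ, triangleWave_half (div_nonneg (by linarith) (by positivity))]
      · simp only [Pi.smul_apply, smul_eq_mul]
        ring
      · rw [div_le_one (by positivity)]
        linarith
    obtain ⟨Ψ, hΨ, hhΨ, hs⟩ := hΦ.triangleWave_pow hρ hK hh hmem (j + 1)
    -- Only one working neuron is needed here; the other receives the wave again and its output is
    -- dropped.
    obtain ⟨Φ', h1, h2, h3, -⟩ := hΨ.layer hρ hK hhΨ (Ψ.sub_mem hs (hΨ.const_mem r)) hs
    refine ⟨Φ', h1, h2, ?_⟩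
    convert h3 using 1
    ext x
    have : (2 : ℝ) ^ (j + 1) * τ x = inner ℝ ξ x + θ - t₀ := by
      rw [hτ, pow_succ]; field_simp
    simp [foldedRelu, this, triangleWave_sub_intCast]

theorem exists_carries_sum {ι : Type*} {C : ℝ} (hC : 1 ≤ C) (x₀ : E d) (ξ : ι → E d)
    (θ r w : ι → ℝ) (hr : ∀ i, 0 ≤ r i) (s : Finset ι) :
    ∃ (n : ℕ) (Φ : Submodule ℝ (E d → ℝ)), s.card ≤ n ∧
      (n : ℝ) ≤ ∑ i ∈ s, 9 / 2 * (Real.logb 2 (2 + C) * Real.logb 2 (2 + oneNorm (ξ i))) ∧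
      Carries (Metric.ball x₀ (C + 1)) n Φ ∧
      (fun x => ∑ i ∈ s, w i * foldedRelu (r i) (inner ℝ (ξ i) x + θ i)) ∈ Φ := by
  classical
  induction s using Finset.induction_on with
  | empty =>
    refine ⟨0, _, by simp, by simp, carries_zero _, ?_⟩
    simp only [Finset.sum_empty]
    exact (affineOn (Metric.ball x₀ (C + 1))).zero_mem
  | insert i s hi ih =>
    obtain ⟨n, Φ, h1, h2, h3, h4⟩ := ih
    obtain ⟨k, hk, hkl, hstep⟩ := exists_layers_foldedRelu hC x₀ (ξ i) (θ i)
    -- Each folded ReLU lies in [0, 1], so the partial sum is bounded by the sum of |w i|; this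
    -- bound lets it be carried through the ReLUs.
    obtain ⟨Φ', g1, g2, g3⟩ := hstep n Φ _ (∑ i ∈ s, |w i|) (r i) h3 (fun x _ => by
      refine (Finset.abs_sum_le_sum_abs _ _).trans (Finset.sum_le_sum fun i _ => ?_)
      rw [abs_mul, abs_of_nonneg (foldedRelu_nonneg _ _)]
      exact mul_le_of_le_one_right (abs_nonneg _) (foldedRelu_le_one (hr i) _)) h4
    refine ⟨n + k, Φ', ?_, ?_, g1, ?_⟩
    · rw [Finset.card_insert_of_notMem hi]; omega
    · rw [Finset.sum_insert hi]; push_cast; linarith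
    · convert Φ'.add_mem (Φ'.smul_mem (w i) g3) g2 using 1
      ext x
      simp [Finset.sum_insert hi]

/-- A finite sum of ridge functions of the triangle wave is a network of width `d + 4` on a ball. -/
theorem exists_isReLUNetwork_eq_sum {ι : Type*} [Fintype ι] [Nonempty ι] {C : ℝ} (hC : 1 ≤ C)
    (x₀ : E d) (ξ : ι → E d) (θ r w : ι → ℝ) (hr : ∀ i, 0 ≤ r i) (β : ℝ) :
    ∃ (L : ℕ) (F : E d → ℝ), IsReLUNetwork L (d + 4) F ∧
      (L : ℝ) ≤ ∑ i, 9 / 2 * (Real.logb 2 (2 + C) * Real.logb 2 (2 + oneNorm (ξ i))) ∧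
      ∀ x ∈ Metric.ball x₀ (C + 1),
        F x = β + ∑ i, w i * foldedRelu (r i) (inner ℝ (ξ i) x + θ i) := by
  obtain ⟨n, Φ, h1, h2, h3, h4⟩ := exists_carries_sum hC x₀ ξ θ r w hr Finset.univ
  -- Each summand costs at least one layer, so a nonempty sum gives a genuine network rather than
  -- the affine case `n = 0`.
  have hn : 1 ≤ n := Fintype.card_pos.trans_le h1
  obtain ⟨k, rfl⟩ := Nat.exists_eq_add_of_le' hn
  obtain ⟨A, a, W, b, hΦ⟩ := h3.computes
  obtain ⟨c, hc⟩ := hΦ (Φ.add_mem (h3.const_mem β) h4)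
  exact ⟨k + 1, fun x => ∑ i, c i * hiddenState A a W b x k i,
    ⟨hn, A, a, W, b, c, fun x => rfl⟩, h2, fun x hx => (hc x hx).symm⟩

/-! ### Networks are globally Lipschitz -/

theorem exists_lipschitzWith_hiddenState (A : Matrix (Fin N) (Fin d) ℝ) (a : Fin N → ℝ)
    (W : ℕ → Matrix (Fin N) (Fin N) ℝ) (b : ℕ → Fin N → ℝ) (k : ℕ) :
    ∃ K, LipschitzWith K fun x : E d => hiddenState A a W b x k := by
  have hrelu : LipschitzWith 1 (relu : (Fin N → ℝ) → Fin N → ℝ) := by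
    refine LipschitzWith.of_dist_le_mul fun u v => ?_
    rw [NNReal.coe_one, one_mul, dist_pi_le_iff dist_nonneg]
    intro i
    rw [Real.dist_eq, relu, relu, max_comm, max_comm 0 (v i)]
    refine (abs_max_sub_max_le_abs ..).trans ?_
    exact dist_le_pi_dist u v i
  have haff : ∀ {M : ℕ} (B : Matrix (Fin N) (Fin M) ℝ) (e : Fin N → ℝ),
      ∃ K, LipschitzWith K fun z : Fin M → ℝ => B.mulVec z + e := by
    intro M B e
    refine ⟨_, ((LinearMap.toContinuousLinearMap (Matrix.mulVecLin B)).lipschitz.add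
      (LipschitzWith.const e))⟩
  induction k with
  | zero =>
    obtain ⟨K, hK⟩ := haff A a
    exact ⟨_, (hrelu.comp hK).comp (PiLp.lipschitzWith_ofLp 2 fun _ : Fin d => ℝ)⟩
  | succ k ih =>
    obtain ⟨K, hK⟩ := haff (W k) (b k)
    obtain ⟨K', hK'⟩ := ih
    exact ⟨_, (hrelu.comp hK).comp hK'⟩

theorem IsReLUNetwork.exists_lipschitzWith {L : ℕ} {F : E d → ℝ} (hF : IsReLUNetwork L N F) :
    ∃ K, LipschitzWith K F := by
  obtain ⟨-, A, a, W, b, c, hc⟩ := hF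
  obtain ⟨K, hK⟩ := exists_lipschitzWith_hiddenState A a W b (L - 1)
  have := (LinearMap.toContinuousLinearMap
    (∑ i, c i • LinearMap.proj (R := ℝ) (φ := fun _ : Fin N => ℝ) i)).lipschitz.comp hK
  have e : F = LinearMap.toContinuousLinearMap
      (∑ i, c i • LinearMap.proj (R := ℝ) (φ := fun _ : Fin N => ℝ) i) ∘
        fun x => hiddenState A a W b x (L - 1) := by
    ext x
    simp [hc x]
  exact ⟨_, e ▸ this⟩

end LogBarron

namespace LogBarron

/-! ### Uniqueness and the inversion formula -/

variable {d : ℕ}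

theorem IsGivenBy.congr {T : 𝓢'(E d, ℂ)} {g g' : E d → ℂ} (h : IsGivenBy T g)
    (hg : g =ᵐ[volume] g') : IsGivenBy T g' := by
  refine ⟨h.1.congr hg, fun φ => ?_⟩
  have e : (fun x => φ x * g x) =ᵐ[volume] fun x => φ x * g' x := by
    filter_upwards [hg] with x hx
    rw [hx]
  exact ⟨(h.2 φ).1.congr e, by rw [(h.2 φ).2, integral_congr_ae e]⟩

/-- This is the fundamental lemma of the calculus of variations: smooth compactly supported
functions are Schwartz functions. It makes the infimum in `spectralNorm` an infimum over a single
value. -/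
theorem IsGivenBy.ae_eq {T : 𝓢'(E d, ℂ)} {g g' : E d → ℂ} (h : IsGivenBy T g)
    (h' : IsGivenBy T g') : g =ᵐ[volume] g' := by
  have := ae_eq_zero_of_integral_contDiff_smul_eq_zero (μ := volume) (h.1.sub h'.1)
    fun φ hφ hφc => by
      have hs : HasCompactSupport fun x => (φ x : ℂ) :=
        hφc.comp_left (g := fun t : ℝ => (t : ℂ)) (by simp)
      have hd : ContDiff ℝ ∞ fun x => (φ x : ℂ) := Complex.ofRealCLM.contDiff.comp hφ
      obtain ⟨i1, e1⟩ := h.2 (hs.toSchwartzMap hd)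
      obtain ⟨i2, e2⟩ := h'.2 (hs.toSchwartzMap hd)
      have := integral_sub i1 i2
      rw [← e1, ← e2, sub_self] at this
      rw [← this]
      congr 1
      ext x
      simp [mul_sub]
  filter_upwards [this] with x hx
  exact sub_eq_zero.1 hx

theorem spectralNorm_eq {f : 𝓢'(E d, ℂ)} {g : E d → ℂ} (hg : IsGivenBy (𝓕 f) g) (w : E d → ℝ) :
    spectralNorm w f = ∫⁻ ξ, ENNReal.ofReal (w ξ) * ‖g ξ‖ₑ := by
  refine le_antisymm (iInf₂_le g hg) (le_iInf₂ fun g' hg' => le_of_eq ?_)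
  refine lintegral_congr_ae ?_
  filter_upwards [hg.ae_eq hg'] with ξ hξ
  rw [hξ]

theorem continuous_fourierInv {g : E d → ℂ} (hint : Integrable g) : Continuous (𝓕⁻ g) := by
  rw [Real.fourierInv_eq_fourier_comp_neg]
  exact VectorFourier.fourierIntegral_continuous Real.continuous_fourierChar
    (by exact continuous_inner) hint.comp_neg

/-- By duality f(φ) = (𝓕 f)(𝓕⁻ φ) = ∫ 𝓕⁻φ · g, and Fubini moves the transform from `φ` to `g`; the
reflection ξ ↦ -ξ reduces this to the identity for 𝓕. -/
theorem isGivenBy_fourierInv (f : 𝓢'(E d, ℂ)) {g : E d → ℂ} (hg : IsGivenBy (𝓕 f) g)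
    (hint : Integrable g) : IsGivenBy f (𝓕⁻ g) := by
  have hcont := continuous_fourierInv hint
  have hbdd : ∀ x, ‖𝓕⁻ g x‖ ≤ ∫ ξ, ‖g ξ‖ := by
    intro x
    rw [Real.fourierInv_eq]
    refine (norm_integral_le_integral_norm _).trans (le_of_eq ?_)
    simp
  refine ⟨hcont.locallyIntegrable, fun φ => ⟨?_, ?_⟩⟩
  · exact φ.integrable.mul_bdd (c := ∫ ξ, ‖g ξ‖) hcont.aestronglyMeasurable (.of_forall hbdd)
  · have h1 : f φ = (𝓕 f) (𝓕⁻ φ) := by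
      rw [TemperedDistribution.fourier_apply, FourierTransform.fourier_fourierInv_eq]
    have h2 : ∫ ξ, 𝓕 (φ : E d → ℂ) ξ * g (-ξ) = ∫ x, φ x * 𝓕 (fun ξ => g (-ξ)) x := by
      simpa using! VectorFourier.integral_bilin_fourierIntegral_eq_flip (.mul ℂ ℂ)
        (L := innerₗ (E d)) Real.continuous_fourierChar continuous_inner φ.integrable hint.comp_neg
    rw [h1, (hg.2 _).2, Real.fourierInv_eq_fourier_comp_neg, ← h2,
      ← integral_neg_eq_self (fun ξ => 𝓕 (φ : E d → ℂ) ξ * g (-ξ))]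
    simp [SchwartzMap.fourierInv_coe, Real.fourierInv_eq_fourier_neg]

theorem IsGivenBy.im_eq_zero {f : 𝓢'(E d, ℂ)} {h : E d → ℂ} (hf : IsGivenBy f h)
    (hreal : IsReal f) (hc : Continuous h) (x : E d) : (h x).im = 0 := by
  have hci : Continuous fun x => (h x).im := Complex.continuous_im.comp hc
  have := ae_eq_zero_of_integral_contDiff_smul_eq_zero (μ := volume) (f := fun x => (h x).im)
    hci.locallyIntegrable fun φ hφ hφc => by
      have hs : HasCompactSupport fun x => (φ x : ℂ) :=
        hφc.comp_left (g := fun t : ℝ => (t : ℂ)) (by simp)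
      have hd : ContDiff ℝ ∞ fun x => (φ x : ℂ) := Complex.ofRealCLM.contDiff.comp hφ
      obtain ⟨i1, e1⟩ := hf.2 (hs.toSchwartzMap hd)
      have h0 := hreal (hs.toSchwartzMap hd) (fun x => by simp)
      rw [e1] at h0
      have := integral_im i1
      simp only [RCLike.im_to_complex] at this
      rw [h0] at this
      rw [← this]
      congr 1
      ext x
      simp
  have h0 : (fun x => (h x).im) = fun _ => 0 :=
    (Continuous.ae_eq_iff_eq volume hci continuous_const).1 this
  exact congrFun h0 x

end LogBarron

namespace LogBarron

/-! ### Monte Carlo sampling -/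

open ProbabilityTheory

/-- The function e/T + q/Q has mean at most 1/4 + 3/4 = 1, so it is at most 1 somewhere, and there
both terms are. The conventions of `ℝ≥0∞` cover T or Q equal to 0 or ∞. -/
theorem exists_le_and_le {Ω : Type*} [MeasurableSpace Ω] (ν : Measure Ω) [IsProbabilityMeasure ν]
    {e q : Ω → ℝ≥0∞} (he : Measurable e) (hq : Measurable q) {T Q : ℝ≥0∞}
    (heT : ∫⁻ σ, e σ ∂ν ≤ 1 / 4 * T) (hqQ : ∫⁻ σ, q σ ∂ν ≤ 3 / 4 * Q) :
    ∃ σ, e σ ≤ T ∧ q σ ≤ Q := by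
  obtain ⟨σ, hσ⟩ := exists_le_lintegral (μ := ν) (f := fun σ => e σ / T + q σ / Q)
    (by fun_prop)
  have h1 : ∫⁻ σ, (e σ / T + q σ / Q) ∂ν ≤ 1 := by
    simp_rw [div_eq_mul_inv]
    rw [lintegral_add_left (by fun_prop), lintegral_mul_const _ he, lintegral_mul_const _ hq]
    calc (∫⁻ σ, e σ ∂ν) * T⁻¹ + (∫⁻ σ, q σ ∂ν) * Q⁻¹
        ≤ (1 / 4 * T) * T⁻¹ + (3 / 4 * Q) * Q⁻¹ := by gcongr
      _ = 1 / 4 * (T / T) + 3 / 4 * (Q / Q) := by simp only [div_eq_mul_inv, mul_assoc]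
      _ ≤ 1 / 4 * 1 + 3 / 4 * 1 := by gcongr <;> exact ENNReal.div_self_le_one
      _ = 1 := by
        rw [mul_one, mul_one, ENNReal.div_add_div_same]
        norm_num
        exact ENNReal.div_self (by norm_num) (by norm_num)
  have h2 := hσ.trans h1
  refine ⟨σ, ?_, ?_⟩
  · simpa using (ENNReal.div_le_iff_le_mul (by simp) (by simp)).1 (le_self_add.trans h2)
  · simpa using (ENNReal.div_le_iff_le_mul (by simp) (by simp)).1 (le_add_self.trans h2)

/-- The mean square error of the empirical mean of `m` independent samples. -/
theorem lintegral_sub_empiricalMean_le {𝒳 : Type*} [MeasurableSpace 𝒳] (P : Measure 𝒳)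
    [IsProbabilityMeasure P] {X : 𝒳 → ℝ} (hX : MemLp X 2 P) {m : ℕ} (hm : 0 < m) :
    ∫⁻ σ : Fin m → 𝒳, ‖∫ y, X y ∂P - (1 / m : ℝ) * ∑ k, X (σ k)‖ₑ ^ 2 ∂(Measure.pi fun _ => P) ≤
      ENNReal.ofReal ((∫ y, X y ^ 2 ∂P) / m) := by
  set ν := Measure.pi fun _ : Fin m => P
  have hm' : (m : ℝ) ≠ 0 := by positivity
  have hXk : ∀ k : Fin m, MemLp (fun σ : Fin m → 𝒳 => X (σ k)) 2 ν := fun k =>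
    hX.comp_measurePreserving (measurePreserving_eval _ k)
  have hmean : ν[fun σ => (1 / m : ℝ) * ∑ k, X (σ k)] = ∫ y, X y ∂P := by
    rw [integral_const_mul, integral_finsetSum _ fun k _ => (hXk k).integrable one_le_two]
    simp only [ν]
    simp_rw [integral_comp_eval (μ := fun _ : Fin m => P) hX.1]
    simp
    field_simp
  have hsum : MemLp (fun σ => (1 / m : ℝ) * ∑ k, X (σ k)) 2 ν :=
    (memLp_finsetSum _ fun k _ => hXk k).const_mul _
  have hvar : Var[fun σ => (1 / m : ℝ) * ∑ k, X (σ k); ν] = Var[X; P] / m := by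
    rw [variance_const_mul]
    have := variance_sum_pi (μ := fun _ : Fin m => P) (X := fun _ => X) fun _ => hX
    have e : (∑ i : Fin m, fun σ : Fin m → 𝒳 => X (σ i)) = fun σ => ∑ k, X (σ k) := by
      ext σ; simp
    rw [e] at this
    rw [this]
    simp
    field_simp
  calc _ = evariance (fun σ => (1 / m : ℝ) * ∑ k, X (σ k)) ν := by
        rw [evariance, hmean]
        simp_rw [← ofReal_norm, norm_sub_rev]
    _ = ENNReal.ofReal (Var[X; P] / m) := by rw [← ofReal_variance hsum, hvar]
    _ ≤ _ := by
        gcongr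
        exact variance_le_expectation_sq hX.1

/-- Fubini integrates the pointwise variance bound over `a`; summing over `i` before estimating uses
only the joint bound `A`, with no factor for the number of components. The index `i` will range over
the function and its partial derivatives. -/
theorem exists_sample {𝒳 α ι : Type*} [MeasurableSpace 𝒳] [MeasurableSpace α] [Fintype ι]
    (P : Measure 𝒳) [IsProbabilityMeasure P] (μ : Measure α) [SFinite μ]
    {X : ι → 𝒳 → α → ℝ} (hX : ∀ i, Measurable (Function.uncurry (X i))) {A : ℝ}
    (hA : ∀ y a, ∑ i, X i y a ^ 2 ≤ A) {q : 𝒳 → ℝ} (hq : Measurable q) (hq0 : ∀ y, 0 ≤ q y)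
    {Q : ℝ} (hQ0 : 0 ≤ Q)
    (hQ : ∫⁻ y, ENNReal.ofReal (q y) ∂P ≤ ENNReal.ofReal Q) {m : ℕ} (hm : 0 < m) :
    ∃ σ : Fin m → 𝒳,
      ∑ i, ∫⁻ a, ‖∫ y, X i y a ∂P - (1 / m : ℝ) * ∑ k, X i (σ k) a‖ₑ ^ 2 ∂μ ≤
        ENNReal.ofReal (4 * A / m) * μ Set.univ ∧
      ∑ k, q (σ k) ≤ 4 / 3 * (m * Q) := by
  have hA0 : ∀ i y a, X i y a ^ 2 ≤ A := fun i y a =>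
    (Finset.single_le_sum (f := fun i => X i y a ^ 2) (fun _ _ => sq_nonneg _)
      (Finset.mem_univ i)).trans (hA y a)
  have hXy : ∀ i a, Measurable fun y => X i y a := fun i a => (hX i).comp measurable_prodMk_right
  have hmem : ∀ i a, MemLp (fun y => X i y a) 2 P := fun i a =>
    MemLp.of_bound (hXy i a).aestronglyMeasurable (√A) (.of_forall fun y =>
      Real.abs_le_sqrt (hA0 i y a))
  have hU : ∀ i, Measurable fun a => ∫ y, X i y a ∂P := fun i => by
    have : StronglyMeasurable (Function.uncurry fun a y => X i y a) :=
      ((hX i).comp measurable_swap).stronglyMeasurable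
    exact this.integral_prod_right.measurable
  have hjoint : ∀ i, Measurable (Function.uncurry fun (σ : Fin m → 𝒳) (a : α) =>
      ‖∫ y, X i y a ∂P - (1 / m : ℝ) * ∑ k, X i (σ k) a‖ₑ ^ 2) := by
    intro i
    have h1 : ∀ k : Fin m, Measurable fun p : (Fin m → 𝒳) × α => X i (p.1 k) p.2 := fun k =>
      (hX i).comp (by fun_prop : Measurable fun p : (Fin m → 𝒳) × α => (p.1 k, p.2))
    have h2 : Measurable fun p : (Fin m → 𝒳) × α => ∫ y, X i y p.2 ∂P := (hU i).comp measurable_snd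
    exact ((h2.sub ((Finset.measurable_sum _ fun k _ => h1 k).const_mul _)).enorm.pow_const 2)
  set ν := Measure.pi fun _ : Fin m => P
  have hqk : ∀ k : Fin m, Measurable fun σ : Fin m → 𝒳 => ENNReal.ofReal (q (σ k)) := fun k =>
    (hq.comp (measurable_pi_apply k)).ennreal_ofReal
  have he : ∫⁻ σ, ∑ i, ∫⁻ a, ‖∫ y, X i y a ∂P - (1 / m : ℝ) * ∑ k, X i (σ k) a‖ₑ ^ 2 ∂μ ∂ν ≤
      1 / 4 * (ENNReal.ofReal (4 * A / m) * μ Set.univ) := by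
    rw [lintegral_finsetSum _ fun i _ => (hjoint i).lintegral_prod_right]
    have : ∀ i, ∫⁻ σ, ∫⁻ a, ‖∫ y, X i y a ∂P - (1 / m : ℝ) * ∑ k, X i (σ k) a‖ₑ ^ 2 ∂μ ∂ν ≤
        ∫⁻ a, ENNReal.ofReal ((∫ y, X i y a ^ 2 ∂P) / m) ∂μ := fun i => by
      rw [lintegral_lintegral_swap (hjoint i).aemeasurable]
      exact lintegral_mono fun a => lintegral_sub_empiricalMean_le P (hmem i a) hm
    have hsq : ∀ i, Measurable fun a => ∫ y, X i y a ^ 2 ∂P := fun i => by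
      have : StronglyMeasurable (Function.uncurry fun a y => X i y a ^ 2) :=
        (((hX i).comp measurable_swap).pow_const 2).stronglyMeasurable
      exact this.integral_prod_right.measurable
    refine (Finset.sum_le_sum fun i _ => this i).trans ?_
    rw [← lintegral_finsetSum _ fun i _ => ((hsq i).div_const _).ennreal_ofReal]
    calc ∫⁻ a, ∑ i, ENNReal.ofReal ((∫ y, X i y a ^ 2 ∂P) / m) ∂μ
        ≤ ∫⁻ _, ENNReal.ofReal (A / m) ∂μ := by
          refine lintegral_mono fun a => ?_
          rw [← ENNReal.ofReal_sum_of_nonneg fun i _ =>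
            div_nonneg (integral_nonneg fun _ => sq_nonneg _) (by positivity), ← Finset.sum_div,
            ← integral_finsetSum _ fun i _ => (hmem i a).integrable_sq]
          gcongr
          refine (integral_mono (integrable_finsetSum _ fun i _ => (hmem i a).integrable_sq)
            (integrable_const A) fun y => hA y a).trans ?_
          simp
      _ = _ := by
          rw [lintegral_const, ← mul_assoc, mul_div_assoc, ENNReal.ofReal_mul (by norm_num),
            ← mul_assoc]
          congr 1
          rw [show ENNReal.ofReal 4 = 4 by simp, one_div, ENNReal.inv_mul_cancel (by norm_num)
            (by norm_num), one_mul]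
  have hcost : ∫⁻ σ, ∑ k, ENNReal.ofReal (q (σ k)) ∂ν ≤
      3 / 4 * ENNReal.ofReal (4 / 3 * (m * Q)) := by
    rw [lintegral_finsetSum _ fun k _ => hqk k]
    have : ∀ k : Fin m, ∫⁻ σ, ENNReal.ofReal (q (σ k)) ∂ν = ∫⁻ y, ENNReal.ofReal (q y) ∂P :=
      fun k => (measurePreserving_eval (fun _ : Fin m => P) k).lintegral_comp hq.ennreal_ofReal
    simp_rw [this]
    rw [Finset.sum_const, Finset.card_univ, Fintype.card_fin, nsmul_eq_mul,
      ENNReal.ofReal_mul (by norm_num), ENNReal.ofReal_mul (by positivity), ENNReal.ofReal_natCast,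
      ← mul_assoc]
    have : (3 / 4 : ℝ≥0∞) * ENNReal.ofReal (4 / 3) = 1 := by
      rw [show (3 / 4 : ℝ≥0∞) = ENNReal.ofReal (3 / 4) by
        rw [ENNReal.ofReal_div_of_pos (by norm_num)]; simp, ← ENNReal.ofReal_mul (by norm_num)]
      norm_num
    rw [this, one_mul]
    gcongr
  obtain ⟨σ, h1, h2⟩ := exists_le_and_le ν
    (Finset.measurable_sum _ fun i _ => (hjoint i).lintegral_prod_right)
    (Finset.measurable_sum _ fun k _ => hqk k) he hcost
  refine ⟨σ, h1, ?_⟩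
  rw [← ENNReal.ofReal_sum_of_nonneg fun k _ => hq0 _] at h2
  exact (ENNReal.ofReal_le_ofReal_iff (by positivity)).1 h2

end LogBarron

namespace LogBarron

/-! ### The random ridge function of a spectral density -/

open scoped unitInterval

variable {d : ℕ}

theorem continuous_oneNorm : Continuous (oneNorm : E d → ℝ) := by
  unfold oneNorm
  fun_prop

/-- The Barron norm density `(1 + |ξ|₁) |g(ξ)|`. -/
noncomputable def barronDensity (g : E d → ℂ) (ξ : E d) : ℝ := (1 + oneNorm ξ) * ‖g ξ‖

theorem barronDensity_nonneg (g : E d → ℂ) (ξ : E d) : 0 ≤ barronDensity g ξ :=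
  mul_nonneg (by linarith [oneNorm_nonneg ξ]) (norm_nonneg _)

theorem measurable_barronDensity {g : E d → ℂ} (hg : Measurable g) :
    Measurable (barronDensity g) :=
  (continuous_oneNorm.measurable.const_add 1).mul hg.norm

/-- The law of a random pair of a frequency and a threshold: frequencies are sampled with density
proportional to `(1 + |ξ|₁) |g(ξ)|`, thresholds uniformly. -/
noncomputable def barronLaw (g : E d → ℂ) (B : ℝ) : Measure (E d × I) :=
  (volume.withDensity fun ξ => ENNReal.ofReal (barronDensity g ξ / B)).prod volume

/-- The phase of `g(ξ)` in units of full turns. -/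
noncomputable def phase (g : E d → ℂ) (ξ : E d) : ℝ := (g ξ).arg / (2 * Real.pi)

theorem measurable_phase {g : E d → ℂ} (hg : Measurable g) : Measurable (phase g) :=
  (Complex.measurable_arg.comp hg).div_const _

/-- The random ridge function whose expectation is `Re 𝓕⁻ g`. -/
noncomputable def atom (g : E d → ℂ) (B : ℝ) (y : E d × I) (x : E d) : ℝ :=
  B / (1 + oneNorm y.1) *
    (1 - Real.pi ^ 2 * Real.cos (Real.pi * y.2) * foldedRelu y.2 (inner ℝ y.1 x + phase g y.1))

/-- The partial derivatives of `atom`. -/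
noncomputable def atomDeriv (g : E d → ℂ) (B : ℝ) (j : Fin d) (y : E d × I) (x : E d) : ℝ :=
  -(B / (1 + oneNorm y.1) * y.1 j *
    (Real.pi ^ 2 * Real.cos (Real.pi * y.2) * foldedSlope y.2 (inner ℝ y.1 x + phase g y.1)))

section law

variable {g : E d → ℂ} {B : ℝ}

theorem lintegral_withDensity_barron (hg : Measurable g) (hB : 0 < B) {q : E d → ℝ≥0∞}
    (hq : Measurable q) :
    ∫⁻ ξ, q ξ ∂(volume.withDensity fun ξ => ENNReal.ofReal (barronDensity g ξ / B)) =
      (∫⁻ ξ, ENNReal.ofReal (barronDensity g ξ) * q ξ) / ENNReal.ofReal B := by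
  have hm := (measurable_barronDensity hg)
  rw [lintegral_withDensity_eq_lintegral_mul _ (hm.div_const B).ennreal_ofReal hq,
    div_eq_mul_inv, ← lintegral_mul_const _ (by fun_prop)]
  refine lintegral_congr fun ξ => ?_
  simp only [Pi.mul_apply]
  rw [ENNReal.ofReal_div_of_pos hB, div_eq_mul_inv]
  ring

theorem isProbabilityMeasure_withDensity_barron (hg : Measurable g) (hB : 0 < B)
    (hgi : Integrable (barronDensity g)) (hBg : ∫ ξ, barronDensity g ξ = B) :
    IsProbabilityMeasure
      (volume.withDensity fun ξ => ENNReal.ofReal (barronDensity g ξ / B)) := by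
  constructor
  rw [← lintegral_one, lintegral_withDensity_barron hg hB measurable_const]
  simp only [mul_one]
  rw [← ofReal_integral_eq_lintegral_ofReal hgi (.of_forall (barronDensity_nonneg g)), hBg]
  exact ENNReal.div_self (by simpa using hB) (by simp)

theorem isProbabilityMeasure_barronLaw (hg : Measurable g) (hB : 0 < B)
    (hgi : Integrable (barronDensity g)) (hBg : ∫ ξ, barronDensity g ξ = B) :
    IsProbabilityMeasure (barronLaw g B) := by
  have := isProbabilityMeasure_withDensity_barron hg hB hgi hBg
  unfold barronLaw
  infer_instance

theorem lintegral_barronLaw_fst (hg : Measurable g) (hB : 0 < B) {q : E d → ℝ≥0∞}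
    (hq : Measurable q) :
    ∫⁻ y, q y.1 ∂(barronLaw g B) =
      (∫⁻ ξ, ENNReal.ofReal (barronDensity g ξ) * q ξ) / ENNReal.ofReal B := by
  have hq' : Measurable fun y : E d × I => q y.1 := hq.comp measurable_fst
  rw [← lintegral_withDensity_barron hg hB hq, barronLaw, lintegral_prod _ hq'.aemeasurable]
  simp

theorem integral_unitInterval_eq (h : ℝ → ℝ) : ∫ r : I, h r = ∫ r in (0 : ℝ)..1, h r := by
  rw [intervalIntegral.integral_of_le zero_le_one, ← integral_Icc_eq_integral_Ioc]
  exact integral_subtype_comap measurableSet_Icc h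

theorem integral_barronLaw (hg : Measurable g) (hB : 0 < B)
    (hgi : Integrable (barronDensity g)) (hBg : ∫ ξ, barronDensity g ξ = B)
    {w : E d → ℝ} {H : E d → ℝ → ℝ}
    (hm : Measurable fun y : E d × I => w y.1 * H y.1 y.2) {K : ℝ}
    (hK : ∀ y : E d × I, |w y.1 * H y.1 y.2| ≤ K) :
    ∫ y, w y.1 * H y.1 y.2 ∂(barronLaw g B) =
      ∫ ξ, (barronDensity g ξ / B) * (w ξ * ∫ r in (0 : ℝ)..1, H ξ r) := by
  have := isProbabilityMeasure_withDensity_barron hg hB hgi hBg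
  rw [barronLaw, integral_prod _ (Integrable.of_bound hm.aestronglyMeasurable K (.of_forall hK)),
    integral_withDensity_eq_integral_toReal_smul
      ((measurable_barronDensity hg).div_const B).ennreal_ofReal (by simp)]
  refine integral_congr_ae (.of_forall fun ξ => ?_)
  simp only [smul_eq_mul]
  rw [ENNReal.toReal_ofReal (div_nonneg (barronDensity_nonneg g ξ) hB.le), integral_const_mul,
    integral_unitInterval_eq]

theorem continuous_foldedRelu : Continuous fun p : ℝ × ℝ => foldedRelu p.1 p.2 := by
  unfold foldedRelu
  exact continuous_const.max ((continuous_triangleWave.comp continuous_snd).sub continuous_fst)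

theorem measurable_foldedSlope : Measurable fun p : ℝ × ℝ => foldedSlope p.1 p.2 := by
  unfold foldedSlope
  exact Measurable.ite (measurableSet_lt measurable_fst
    (continuous_triangleWave.measurable.comp measurable_snd))
    (measurable_triangleSlope.comp measurable_snd) measurable_const

theorem measurable_ridge (hg : Measurable g) :
    Measurable fun p : (E d × I) × E d =>
      ((p.1.2 : ℝ), inner ℝ p.1.1 p.2 + phase g p.1.1) := by
  have h1 : Measurable fun p : (E d × I) × E d => phase g p.1.1 :=
    (measurable_phase hg).comp (measurable_fst.comp measurable_fst)
  have h2 : Measurable fun p : (E d × I) × E d => inner ℝ p.1.1 p.2 :=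
    (by fun_prop : Continuous fun p : (E d × I) × E d => inner ℝ p.1.1 p.2).measurable
  have h3 : Measurable fun p : (E d × I) × E d => (p.1.2 : ℝ) :=
    (by fun_prop : Continuous fun p : (E d × I) × E d => (p.1.2 : ℝ)).measurable
  exact h3.prodMk (h2.add h1)

theorem measurable_weight (B : ℝ) : Measurable fun p : (E d × I) × E d =>
    B / (1 + oneNorm p.1.1) :=
  ((continuous_oneNorm.measurable.comp (measurable_fst.comp measurable_fst)).const_add 1).const_div B

theorem measurable_cos_threshold : Measurable fun p : (E d × I) × E d =>
    Real.pi ^ 2 * Real.cos (Real.pi * p.1.2) :=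
  (by fun_prop : Continuous fun p : (E d × I) × E d =>
    Real.pi ^ 2 * Real.cos (Real.pi * p.1.2)).measurable

theorem measurable_atom (hg : Measurable g) : Measurable (Function.uncurry (atom g B)) :=
  (measurable_weight B).mul ((measurable_cos_threshold.mul
    (continuous_foldedRelu.measurable.comp (measurable_ridge hg))).const_sub 1)

theorem measurable_atomDeriv (hg : Measurable g) (j : Fin d) :
    Measurable (Function.uncurry (atomDeriv g B j)) := by
  have hj : Measurable fun p : (E d × I) × E d => p.1.1 j :=
    (by fun_prop : Continuous fun p : (E d × I) × E d => p.1.1 j).measurable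
  exact (((measurable_weight B).mul hj).mul (measurable_cos_threshold.mul
    (measurable_foldedSlope.comp (measurable_ridge hg)))).neg

theorem sum_sq_le_oneNorm_sq (ξ : E d) : ∑ j, ξ j ^ 2 ≤ oneNorm ξ ^ 2 := by
  simpa [oneNorm] using Finset.sum_sq_le_sq_sum_of_nonneg (s := Finset.univ)
    (f := fun i => |ξ i|) fun _ _ => abs_nonneg _

/-- Both bracketed factors are at most 2π² in absolute value, using 1 + π² ≤ 2π² for the first and
slope at most 2 for the second. The weight absorbs the frequency because 1 + |ξ|₁² ≤ (1 + |ξ|₁)². -/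
theorem atom_sq_add_sum_atomDeriv_sq_le (hB : 0 < B) (y : E d × I) (x : E d) :
    atom g B y x ^ 2 + ∑ j, atomDeriv g B j y x ^ 2 ≤ 4 * Real.pi ^ 4 * B ^ 2 := by
  obtain ⟨ξ, r, hr⟩ := y
  have hξ := oneNorm_nonneg ξ
  have hpi := Real.pi_gt_three
  set t := inner ℝ ξ x + phase g ξ with ht
  have hc := Real.abs_cos_le_one (Real.pi * r)
  have h1 : |1 - Real.pi ^ 2 * Real.cos (Real.pi * r) * foldedRelu r t| ≤ 2 * Real.pi ^ 2 := by
    have : |Real.cos (Real.pi * r) * foldedRelu r t| ≤ 1 := by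
      rw [abs_mul, abs_of_nonneg (foldedRelu_nonneg r t)]
      exact mul_le_one₀ hc (foldedRelu_nonneg r t) (foldedRelu_le_one hr.1 t)
    rw [abs_le] at this ⊢
    constructor <;> nlinarith [sq_nonneg Real.pi]
  have h2 : |Real.pi ^ 2 * Real.cos (Real.pi * r) * foldedSlope r t| ≤ 2 * Real.pi ^ 2 := by
    have : |Real.cos (Real.pi * r) * foldedSlope r t| ≤ 1 * 2 := by
      rw [abs_mul]
      exact mul_le_mul hc (abs_foldedSlope_le r t) (abs_nonneg _) zero_le_one
    rw [mul_assoc, abs_mul, abs_of_nonneg (sq_nonneg Real.pi)]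
    nlinarith [sq_nonneg Real.pi]
  have h1' := sq_le_sq' (abs_le.1 h1).1 (abs_le.1 h1).2
  have h2' := sq_le_sq' (abs_le.1 h2).1 (abs_le.1 h2).2
  have hs := sum_sq_le_oneNorm_sq ξ
  have hw : (B / (1 + oneNorm ξ)) ^ 2 * (1 + oneNorm ξ ^ 2) ≤ B ^ 2 := by
    rw [div_pow, div_mul_eq_mul_div, div_le_iff₀ (by positivity)]
    gcongr
    nlinarith
  have e : ∑ j, atomDeriv g B j (ξ, ⟨r, hr⟩) x ^ 2 = (B / (1 + oneNorm ξ)) ^ 2 *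
      (Real.pi ^ 2 * Real.cos (Real.pi * r) * foldedSlope r t) ^ 2 * ∑ j, ξ j ^ 2 := by
    rw [Finset.mul_sum]
    refine Finset.sum_congr rfl fun j _ => ?_
    simp only [atomDeriv, ← ht]
    ring
  rw [e, atom, mul_pow, ← ht]
  calc _ ≤ (B / (1 + oneNorm ξ)) ^ 2 * (2 * Real.pi ^ 2) ^ 2 +
        (B / (1 + oneNorm ξ)) ^ 2 * (2 * Real.pi ^ 2) ^ 2 * oneNorm ξ ^ 2 := by
        gcongr
    _ = 4 * Real.pi ^ 4 * ((B / (1 + oneNorm ξ)) ^ 2 * (1 + oneNorm ξ ^ 2)) := by ring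
    _ ≤ _ := by gcongr

/-- The weight B/(1 + |ξ|₁) cancels the sampling density down to |g(ξ)|, and averaging over the
threshold restores the cosine. -/
theorem integral_atom (hg : Measurable g) (hB : 0 < B)
    (hgi : Integrable (barronDensity g)) (hBg : ∫ ξ, barronDensity g ξ = B) (x : E d) :
    ∫ y, atom g B y x ∂(barronLaw g B) =
      ∫ ξ, ‖g ξ‖ * Real.cos (2 * Real.pi * (inner ℝ ξ x + phase g ξ)) := by
  have hm : Measurable fun y : E d × I => atom g B y x :=
    Measurable.of_uncurry_right (measurable_atom (B := B) hg)
  have hK : ∀ y : E d × I, |atom g B y x| ≤ √(4 * Real.pi ^ 4 * B ^ 2) := fun y => by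
    have h : atom g B y x ^ 2 ≤ 4 * Real.pi ^ 4 * B ^ 2 :=
      (le_add_of_nonneg_right (Finset.sum_nonneg fun _ _ => sq_nonneg _)).trans
        (atom_sq_add_sum_atomDeriv_sq_le hB y x)
    exact Real.abs_le_sqrt h
  unfold atom at hm hK ⊢
  have key := integral_barronLaw hg hB hgi hBg (w := fun ξ => B / (1 + oneNorm ξ))
    (H := fun ξ r => 1 - Real.pi ^ 2 * Real.cos (Real.pi * r) *
      foldedRelu r (inner ℝ ξ x + phase g ξ)) hm hK
  simp only [integral_one_sub_foldedRelu] at key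
  rw [key]
  refine integral_congr_ae (.of_forall fun ξ => ?_)
  have := oneNorm_nonneg ξ
  simp only [barronDensity]
  field_simp

theorem integral_atomDeriv (hg : Measurable g) (hB : 0 < B)
    (hgi : Integrable (barronDensity g)) (hBg : ∫ ξ, barronDensity g ξ = B) (j : Fin d)
    (x : E d) :
    ∫ y, atomDeriv g B j y x ∂(barronLaw g B) =
      ∫ ξ, -(‖g ξ‖ * ξ j *
        (2 * Real.pi * Real.sin (2 * Real.pi * (inner ℝ ξ x + phase g ξ)))) := by
  rw [integral_neg]
  unfold atomDeriv
  rw [integral_neg]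
  congr 1
  refine (integral_barronLaw hg hB hgi hBg (w := fun ξ => B / (1 + oneNorm ξ) * ξ j)
    (H := fun ξ r => Real.pi ^ 2 * Real.cos (Real.pi * r) *
      foldedSlope r (inner ℝ ξ x + phase g ξ))
    ?_ (K := √(4 * Real.pi ^ 4 * B ^ 2))
    fun y => ?_).trans (integral_congr_ae (.of_forall fun ξ => ?_))
  · convert ((measurable_atomDeriv (B := B) hg j).comp (measurable_prodMk_right (y := x))).neg
      using 1
    ext y
    simp [atomDeriv]
  · have h : atomDeriv g B j y x ^ 2 ≤ 4 * Real.pi ^ 4 * B ^ 2 := (Finset.single_le_sum (f := fun j => atomDeriv g B j y x ^ 2)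
      (fun _ _ => sq_nonneg _) (Finset.mem_univ j)).trans
      ((le_add_of_nonneg_left (sq_nonneg _)).trans (atom_sq_add_sum_atomDeriv_sq_le hB y x))
    rw [atomDeriv, neg_sq] at h
    exact Real.abs_le_sqrt h
  · have := oneNorm_nonneg ξ
    simp only [integral_foldedSlope, barronDensity]
    field_simp

theorem hasLineDerivAt_atom {y : E d × I} {x : E d} (j : Fin d)
    (h : HasDerivAt (foldedRelu y.2) (foldedSlope y.2 (inner ℝ y.1 x + phase g y.1))
      (inner ℝ y.1 x + phase g y.1)) :
    HasLineDerivAt ℝ (atom g B y) (atomDeriv g B j y x) x (EuclideanSpace.single j 1) := by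
  have hl : HasDerivAt (fun s : ℝ => inner ℝ y.1 (x + s • EuclideanSpace.single j (1 : ℝ)) +
      phase g y.1) (y.1 j) 0 := by
    have : (fun s : ℝ => inner ℝ y.1 (x + s • EuclideanSpace.single j (1 : ℝ)) + phase g y.1) =
        fun s => s * y.1 j + (inner ℝ y.1 x + phase g y.1) := by
      ext s
      rw [inner_add_right, inner_smul_right, EuclideanSpace.inner_single_right]
      simp
      ring
    rw [this]
    simpa using ((hasDerivAt_id (0 : ℝ)).mul_const (y.1 j)).add_const
      (inner ℝ y.1 x + phase g y.1)
  have hc := HasDerivAt.comp (h₂ := foldedRelu y.2) (0 : ℝ) (by simpa using h) hl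
  have := ((hc.const_mul (Real.pi ^ 2 * Real.cos (Real.pi * y.2))).const_sub 1).const_mul
    (B / (1 + oneNorm y.1))
  refine HasDerivAt.congr_deriv this ?_
  simp only [atomDeriv]
  ring

/-- A surjective linear map pulls null sets back to null sets, so the kinks of a ridge function fill
only a null set of hyperplanes. -/
theorem ae_inner_add_notMem {ξ : E d} (hξ : ξ ≠ 0) (c : ℝ) {s : Set ℝ} (hs : s.Countable) :
    ∀ᵐ x : E d, inner ℝ ξ x + c ∉ s := by
  have hsurj : Function.Surjective (innerₗ (E d) ξ) := by
    intro t
    refine ⟨(t / ‖ξ‖ ^ 2) • ξ, ?_⟩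
    have : ‖ξ‖ ≠ 0 := norm_ne_zero_iff.2 hξ
    simp
    field_simp
  have hs' : ((fun t => t + c) ⁻¹' s).Countable := hs.preimage (add_left_injective c)
  have := (ae_comp_linearMap_mem_iff (innerₗ (E d) ξ) volume volume hsurj
    (s := ((fun t => t + c) ⁻¹' s)ᶜ) hs'.measurableSet.compl).2
    (hs'.ae_notMem volume)
  filter_upwards [this] with x hx
  exact hx

theorem ae_hasLineDerivAt_atom (g : E d → ℂ) (B : ℝ) (y : E d × I) :
    ∀ᵐ x : E d, ∀ j, HasLineDerivAt ℝ (atom g B y) (atomDeriv g B j y x) x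
      (EuclideanSpace.single j 1) := by
  -- At frequency zero the ridge could sit on a kink for every `x`, but the atom is then constant.
  by_cases hy : y.1 = 0
  · refine .of_forall fun x j => ?_
    have h1 : atom g B y = fun _ => atom g B y 0 := by
      ext x; simp [atom, hy]
    have h2 : atomDeriv g B j y x = 0 := by simp [atomDeriv, hy]
    rw [h1, h2]
    exact hasDerivAt_const _ _
  · obtain ⟨s, hs, hd⟩ := exists_countable_hasDerivAt_foldedRelu (y.2 : ℝ)
    filter_upwards [ae_inner_add_notMem hy (phase g y.1) hs] with x hx j
    exact hasLineDerivAt_atom j (hd _ hx)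

end law

end LogBarron

namespace LogBarron

/-! ### The function given by a spectral density -/

open scoped unitInterval

variable {d : ℕ}

/-- The function `x ↦ ∫ |g(ξ)| cos (2π ξ·x + arg g(ξ)) dξ = Re 𝓕⁻ g(x)`. -/
noncomputable def spectralFun (g : E d → ℂ) (x : E d) : ℝ :=
  ∫ ξ, ‖g ξ‖ * Real.cos (2 * Real.pi * (inner ℝ ξ x + phase g ξ))

section

variable {g : E d → ℂ}

theorem norm_le_barronDensity (g : E d → ℂ) (ξ : E d) : ‖g ξ‖ ≤ barronDensity g ξ :=
  le_mul_of_one_le_left (norm_nonneg _) (by linarith [oneNorm_nonneg ξ])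

theorem oneNorm_mul_norm_le_barronDensity (g : E d → ℂ) (ξ : E d) :
    oneNorm ξ * ‖g ξ‖ ≤ barronDensity g ξ :=
  mul_le_mul_of_nonneg_right (by linarith) (norm_nonneg _)

theorem integrable_of_barronDensity (hg : Measurable g) (hgi : Integrable (barronDensity g)) :
    Integrable g :=
  hgi.mono' hg.aestronglyMeasurable (.of_forall (norm_le_barronDensity g))

theorem re_fourierInv (hg : Measurable g) (hint : Integrable g) (x : E d) :
    (𝓕⁻ g x).re = spectralFun g x := by
  have hi : Integrable fun ξ : E d =>
      Complex.exp (((2 * Real.pi * inner ℝ ξ x : ℝ) : ℂ) * Complex.I) • g ξ := by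
    refine hint.mono ?_ (.of_forall fun ξ => ?_)
    · exact ((by fun_prop : Continuous fun ξ : E d =>
        Complex.exp (((2 * Real.pi * inner ℝ ξ x : ℝ) : ℂ) * Complex.I)).measurable.smul
          hg).aestronglyMeasurable
    · rw [norm_smul, Complex.norm_exp_ofReal_mul_I, one_mul]
  rw [Real.fourierInv_eq', ← RCLike.re_eq_complex_re, ← integral_re hi, spectralFun]
  refine integral_congr_ae (.of_forall fun ξ => ?_)
  simp only [RCLike.re_eq_complex_re, smul_eq_mul]
  conv_lhs => rw [← Complex.norm_mul_exp_arg_mul_I (g ξ)]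
  rw [mul_left_comm, ← Complex.exp_add, ← add_mul, ← Complex.ofReal_add, Complex.re_ofReal_mul,
    Complex.exp_ofReal_mul_I_re, phase]
  congr 2
  field_simp

theorem measurable_inner_add_phase (hg : Measurable g) (x : E d) :
    Measurable fun ξ : E d => 2 * Real.pi * (inner ℝ ξ x + phase g ξ) :=
  ((by fun_prop : Continuous fun ξ : E d => inner ℝ ξ x).measurable.add
    (measurable_phase hg)).const_mul _

theorem integrable_norm_mul_cos (hg : Measurable g) (hint : Integrable g) (x : E d) :
    Integrable fun ξ => ‖g ξ‖ * Real.cos (2 * Real.pi * (inner ℝ ξ x + phase g ξ)) :=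
  hint.norm.mul_bdd (c := 1)
    (Real.measurable_cos.comp (measurable_inner_add_phase hg x)).aestronglyMeasurable
    (.of_forall fun _ => Real.abs_cos_le_one _)

/-- Differentiation under the integral is dominated by 2π(1 + |ξ|₁)|g(ξ)|, which is where the
first-order Barron norm enters. -/
theorem hasLineDerivAt_spectralFun (hg : Measurable g) (hgi : Integrable (barronDensity g))
    (x : E d) (j : Fin d) :
    HasLineDerivAt ℝ (spectralFun g) (∫ ξ, -(‖g ξ‖ * ξ j *
        (2 * Real.pi * Real.sin (2 * Real.pi * (inner ℝ ξ x + phase g ξ))))) x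
      (EuclideanSpace.single j 1) := by
  have hint := integrable_of_barronDensity hg hgi
  have hj : Measurable fun ξ : E d => ξ j :=
    (by fun_prop : Continuous fun ξ : E d => ξ j).measurable
  have key := (hasDerivAt_integral_of_dominated_loc_of_deriv_le (μ := volume) (x₀ := (0 : ℝ))
    (s := Set.univ) (bound := fun ξ => 2 * Real.pi * barronDensity g ξ)
    (F := fun s ξ => ‖g ξ‖ * Real.cos (2 * Real.pi *
      (inner ℝ ξ (x + s • EuclideanSpace.single j (1 : ℝ)) + phase g ξ)))
    (F' := fun s ξ => -(‖g ξ‖ * ξ j * (2 * Real.pi * Real.sin (2 * Real.pi *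
      (inner ℝ ξ (x + s • EuclideanSpace.single j (1 : ℝ)) + phase g ξ)))))
    Filter.univ_mem (.of_forall fun s => (integrable_norm_mul_cos hg hint _).aestronglyMeasurable)
    (integrable_norm_mul_cos hg hint _) ?_ ?_ (hgi.const_mul _) ?_).2
  · simpa [HasLineDerivAt, spectralFun] using key
  · exact ((hg.norm.mul hj).mul ((Real.measurable_sin.comp
      (measurable_inner_add_phase hg _)).const_mul _)).neg.aestronglyMeasurable
  · refine .of_forall fun ξ s _ => ?_
    have h1 : |ξ j| ≤ oneNorm ξ :=
      Finset.single_le_sum (f := fun i => |ξ i|) (fun _ _ => abs_nonneg _) (Finset.mem_univ j)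
    have h2 := Real.abs_sin_le_one (2 * Real.pi *
      (inner ℝ ξ (x + s • EuclideanSpace.single j (1 : ℝ)) + phase g ξ))
    have h3 := oneNorm_mul_norm_le_barronDensity g ξ
    rw [norm_neg, Real.norm_eq_abs, abs_mul, abs_mul, abs_mul, abs_norm,
      abs_of_pos Real.two_pi_pos]
    calc _ ≤ ‖g ξ‖ * oneNorm ξ * (2 * Real.pi * 1) := by
          have := Real.pi_pos
          have := oneNorm_nonneg ξ
          gcongr
      _ = 2 * Real.pi * (oneNorm ξ * ‖g ξ‖) := by ring
      _ ≤ _ := by gcongr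
  · refine .of_forall fun ξ s _ => ?_
    have hl : HasDerivAt (fun s : ℝ => 2 * Real.pi *
        (inner ℝ ξ (x + s • EuclideanSpace.single j (1 : ℝ)) + phase g ξ))
        (2 * Real.pi * ξ j) s := by
      have : (fun s : ℝ => 2 * Real.pi *
          (inner ℝ ξ (x + s • EuclideanSpace.single j (1 : ℝ)) + phase g ξ)) =
          fun s => 2 * Real.pi * (s * ξ j + (inner ℝ ξ x + phase g ξ)) := by
        ext s
        rw [inner_add_right, inner_smul_right, EuclideanSpace.inner_single_right]
        simp
        ring
      rw [this]
      simpa using (((hasDerivAt_id s).mul_const (ξ j)).add_const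
        (inner ℝ ξ x + phase g ξ)).const_mul (2 * Real.pi)
    refine (hl.cos.const_mul _).congr_deriv ?_
    ring

theorem lipschitzWith_spectralFun (hg : Measurable g) (hgi : Integrable (barronDensity g)) :
    LipschitzWith (Real.toNNReal (2 * Real.pi * ∫ ξ, barronDensity g ξ)) (spectralFun g) := by
  have hint := integrable_of_barronDensity hg hgi
  refine LipschitzWith.of_dist_le' fun x y => ?_
  rw [dist_eq_norm, spectralFun, spectralFun, ← integral_sub (integrable_norm_mul_cos hg hint x)
    (integrable_norm_mul_cos hg hint y), ← integral_const_mul, ← integral_mul_const]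
  refine norm_integral_le_of_norm_le ((hgi.const_mul _).mul_const _) (.of_forall fun ξ => ?_)
  rw [← mul_sub, norm_mul, norm_norm]
  have h1 : |Real.cos (2 * Real.pi * (inner ℝ ξ x + phase g ξ)) -
      Real.cos (2 * Real.pi * (inner ℝ ξ y + phase g ξ))| ≤
      2 * Real.pi * (oneNorm ξ * dist x y) := by
    refine (Real.abs_cos_sub_cos_le _ _).trans ?_
    rw [← mul_sub, add_sub_add_right_eq_sub, ← inner_sub_right, abs_mul,
      abs_of_pos Real.two_pi_pos, dist_eq_norm]
    gcongr
    exact abs_inner_le_oneNorm_mul_norm ξ _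
  calc _ ≤ ‖g ξ‖ * (2 * Real.pi * (oneNorm ξ * dist x y)) := by
        gcongr
        exact h1
    _ = 2 * Real.pi * (oneNorm ξ * ‖g ξ‖) * dist x y := by ring
    _ ≤ _ := by
        have := Real.pi_pos
        gcongr
        exact oneNorm_mul_norm_le_barronDensity g ξ

end

/-! ### Weak derivatives -/

/-- Integration by parts for Lipschitz functions. Weak derivatives here are taken on all of ℝᵈ,
hence the need for global Lipschitz bounds, although the network is explicit only on a ball. -/
theorem hasWeakPartialDeriv_lineDeriv {K : NNReal} {w : E d → ℝ} (hw : LipschitzWith K w)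
    (j : Fin d) :
    HasWeakPartialDeriv j w fun x => lineDeriv ℝ w x (EuclideanSpace.single j 1) := by
  refine ⟨hw.continuous.locallyIntegrable, hw.locallyIntegrable_lineDeriv _, fun φ hφ hφc => ?_⟩
  obtain ⟨D, hD⟩ := (hφ.of_le (by simp) : ContDiff ℝ 1 φ).lipschitzWith_of_hasCompactSupport hφc
    one_ne_zero
  rw [hw.integral_lineDeriv_mul_eq hD hφc, ← integral_neg]
  refine integral_congr_ae (.of_forall fun x => ?_)
  simp only
  rw [(hφ.differentiable (by simp)).differentiableAt.lineDeriv_eq_fderiv]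
  simp [mul_comm]

theorem h1Norm_le {K : NNReal} {w : E d → ℝ} (hw : LipschitzWith K w) {Ω : Set (E d)}
    (hΩ : MeasurableSet Ω) {v : Fin d → E d → ℝ}
    (hv : ∀ᵐ x, x ∈ Ω → ∀ j, lineDeriv ℝ w x (EuclideanSpace.single j 1) = v j x) :
    h1Norm Ω w ≤
      ((∫⁻ x in Ω, ‖w x‖ₑ ^ 2) + ∑ j, ∫⁻ x in Ω, ‖v j x‖ₑ ^ 2) ^ (1 / 2 : ℝ) := by
  refine (iInf₂_le _ fun j => hasWeakPartialDeriv_lineDeriv hw j).trans (le_of_eq ?_)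
  congr 2
  refine Finset.sum_congr rfl fun j _ => lintegral_congr_ae ?_
  rw [Filter.EventuallyEq, ae_restrict_iff' hΩ]
  filter_upwards [hv] with x hx hxΩ
  rw [hx hxΩ j]

/-! ### Approximation -/

theorem exists_isReLUNetwork_h1Norm_le {g : E d → ℂ} {B Λ : ℝ} (hg : Measurable g) (hB : 0 < B)
    (hgi : Integrable (barronDensity g)) (hBg : ∫ ξ, barronDensity g ξ = B) (hΛ : 0 ≤ Λ)
    (hΛg : ∫⁻ ξ, ENNReal.ofReal (barronDensity g ξ) *
      ENNReal.ofReal (Real.logb 2 (2 + oneNorm ξ)) ≤ ENNReal.ofReal Λ)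
    {m : ℕ} (hm : 0 < m) {Ω : Set (E d)} (hΩ : MeasurableSet Ω) {x₀ : E d} {C : ℝ} (hC : 1 ≤ C)
    (hΩC : Ω ⊆ Metric.closedBall x₀ C) :
    ∃ (L : ℕ) (F : E d → ℝ), IsReLUNetwork L (d + 4) F ∧
      (L : ℝ) ≤ 6 * m * Real.logb 2 (2 + C) * (Λ / B) ∧
      h1Norm Ω (fun x => spectralFun g x - F x) ≤
        (ENNReal.ofReal (16 * Real.pi ^ 4 * B ^ 2 / m) * volume Ω) ^ (1 / 2 : ℝ) := by
  have := isProbabilityMeasure_barronLaw hg hB hgi hBg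
  have hlog : Measurable fun ξ : E d => Real.logb 2 (2 + oneNorm ξ) :=
    (Real.measurable_log.comp (continuous_oneNorm.measurable.const_add 2)).div_const _
  obtain ⟨τ, herr, hcost⟩ := exists_sample (barronLaw g B) (volume.restrict Ω)
    -- `none` stands for the function and `some j` for its j-th derivative, so one sample serves the
    -- whole H¹ norm.
    (X := fun i : Option (Fin d) => i.elim (atom g B) (atomDeriv g B))
    (fun i => by
      cases i with
      | none => exact measurable_atom hg
      | some j => exact measurable_atomDeriv hg j)
    (A := 4 * Real.pi ^ 4 * B ^ 2)
    (fun y x => by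
      simpa [Fintype.sum_option] using atom_sq_add_sum_atomDeriv_sq_le hB y x)
    (q := fun y => Real.logb 2 (2 + oneNorm y.1)) (hlog.comp measurable_fst)
    (fun y => zero_le_one.trans (one_le_logb_two_add_oneNorm _)) (Q := Λ / B) (by positivity)
    (by
      rw [lintegral_barronLaw_fst hg hB (q := fun ξ => ENNReal.ofReal (Real.logb 2 (2 + oneNorm ξ)))
        hlog.ennreal_ofReal, ENNReal.ofReal_div_of_pos hB]
      gcongr) hm
  have : Nonempty (Fin m) := ⟨⟨0, hm⟩⟩
  obtain ⟨L, F, hF, hL, hFS⟩ := exists_isReLUNetwork_eq_sum hC x₀ (fun k => (τ k).1)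
    (fun k => phase g (τ k).1) (fun k => ((τ k).2 : ℝ))
    (fun k => -((1 / m : ℝ) * (B / (1 + oneNorm (τ k).1) *
      (Real.pi ^ 2 * Real.cos (Real.pi * (τ k).2)))))
    (fun k => (τ k).2.2.1) ((1 / m : ℝ) * ∑ k, B / (1 + oneNorm (τ k).1))
  have hFS' : ∀ x ∈ Metric.ball x₀ (C + 1), F x = (1 / m : ℝ) * ∑ k, atom g B (τ k) x := by
    intro x hx
    rw [hFS x hx, Finset.mul_sum, Finset.mul_sum, ← Finset.sum_add_distrib]
    refine Finset.sum_congr rfl fun k _ => ?_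
    rw [atom]
    ring
  -- The extra radius 1 makes network and sampled sum agree on a neighbourhood of each point of `Ω`,
  -- so their derivatives agree there too.
  have hΩS : Ω ⊆ Metric.ball x₀ (C + 1) :=
    hΩC.trans (Metric.closedBall_subset_ball (by linarith))
  refine ⟨L, F, hF, ?_, ?_⟩
  · rw [← Finset.mul_sum, ← Finset.mul_sum] at hL
    have := three_halves_le_logb hC
    calc (L : ℝ) ≤ _ := hL
      _ ≤ 9 / 2 * (Real.logb 2 (2 + C) * (4 / 3 * (m * (Λ / B)))) := by gcongr
      _ = _ := by ring
  · obtain ⟨K, hK⟩ := hF.exists_lipschitzWith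
    refine (h1Norm_le ((lipschitzWith_spectralFun hg hgi).sub hK) hΩ
      (v := fun j x => ∫ y, atomDeriv g B j y x ∂(barronLaw g B) -
        (1 / m : ℝ) * ∑ k, atomDeriv g B j (τ k) x) ?_).trans ?_
    · filter_upwards [ae_all_iff.2 fun k => ae_hasLineDerivAt_atom g B (τ k)] with x hx hxΩ j
      refine HasLineDerivAt.lineDeriv ?_
      have h1 := hasLineDerivAt_spectralFun hg hgi x j
      rw [← integral_atomDeriv hg hB hgi hBg] at h1
      have h2 : HasLineDerivAt ℝ (fun x => spectralFun g x - (1 / m : ℝ) * ∑ k, atom g B (τ k) x)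
          (∫ y, atomDeriv g B j y x ∂(barronLaw g B) -
            (1 / m : ℝ) * ∑ k, atomDeriv g B j (τ k) x) x (EuclideanSpace.single j 1) :=
        HasDerivAt.fun_sub h1 ((HasDerivAt.fun_sum fun k _ => hx k j).const_mul _)
      refine h2.congr_of_eventuallyEq ?_
      filter_upwards [Metric.isOpen_ball.mem_nhds (hΩS hxΩ)] with z hz
      rw [hFS' z hz]
    · gcongr
      rw [Fintype.sum_option, Measure.restrict_apply_univ] at herr
      simp only [Option.elim] at herr
      have e : ∫⁻ x in Ω, ‖spectralFun g x - F x‖ₑ ^ 2 = ∫⁻ x in Ω,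
          ‖∫ y, atom g B y x ∂(barronLaw g B) - (1 / m : ℝ) * ∑ k, atom g B (τ k) x‖ₑ ^ 2 := by
        refine setLIntegral_congr_fun hΩ fun x hx => ?_
        rw [integral_atom hg hB hgi hBg, hFS' x (hΩS hx), spectralFun]
      rw [e]
      refine herr.trans (le_of_eq ?_)
      congr 3
      ring

end LogBarron

/-! ### Assembly of the main theorem -/

open LogBarron
theorem mainTheorem4 (d : ℕ) (hd : 0 < d) (f : 𝓢'(E d, ℂ)) (hreal : IsReal f)
    (hf : MemLogBarron 1 f) (hf0 : f ≠ 0) (m : ℕ) (hm : 0 < m)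
    (Ω : Set (E d)) (hΩ : IsCompact Ω) :
    ∃ u : E d → ℝ, IsGivenBy f (fun x => (u x : ℂ)) ∧
      ∃ (L : ℕ) (F : E d → ℝ), IsReLUNetwork L (d + 4) F ∧
        (L : ℝ) ≤ 6 * m * C₂ Ω * Real.logb 2 (2 + C₂ Ω) *
          ((logBarronNorm 1 f).toReal / (barronNorm 1 f).toReal) ∧
        h1Norm Ω (fun x => u x - F x) ≤
          ENNReal.ofReal (4 * Real.pi ^ 2 / √(m : ℝ) * C₂ Ω *
            √((volume Ω).toReal) * (barronNorm 1 f).toReal) := by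
  obtain ⟨g, hg, hgm⟩ : ∃ g, IsGivenBy (𝓕 f) g ∧ Measurable g := by
    obtain ⟨g₀, hg₀⟩ := iInf_lt_iff.1 hf
    obtain ⟨hg₀, -⟩ := iInf_lt_iff.1 hg₀
    have hg₀m := hg₀.1.aestronglyMeasurable
    exact ⟨hg₀m.mk g₀, hg₀.congr hg₀m.ae_eq_mk, hg₀m.stronglyMeasurable_mk.measurable⟩
  have hdens : ∀ ξ, ENNReal.ofReal (barronDensity g ξ) = ENNReal.ofReal (1 + oneNorm ξ) * ‖g ξ‖ₑ :=
    fun ξ => by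
      rw [barronDensity, ENNReal.ofReal_mul (by linarith [oneNorm_nonneg ξ]), ofReal_norm]
  have hbarron : barronNorm 1 f = ∫⁻ ξ, ENNReal.ofReal (barronDensity g ξ) := by
    rw [barronNorm, spectralNorm_eq hg]
    simp only [Real.rpow_one, hdens]
  have hlogb : logBarronNorm 1 f = ∫⁻ ξ, ENNReal.ofReal (barronDensity g ξ) *
      ENNReal.ofReal (Real.logb 2 (2 + oneNorm ξ)) := by
    rw [logBarronNorm, spectralNorm_eq hg]
    refine lintegral_congr fun ξ => ?_
    rw [hdens, Real.rpow_one, ENNReal.ofReal_mul (by linarith [oneNorm_nonneg ξ])]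
    ring
  have hle : barronNorm 1 f ≤ logBarronNorm 1 f := by
    rw [hbarron, hlogb]
    exact lintegral_mono fun ξ => le_mul_of_one_le_right' (by
      simpa using one_le_logb_two_add_oneNorm ξ)
  have hdm := measurable_barronDensity hgm
  have hd0 := barronDensity_nonneg g
  have hgi : Integrable (barronDensity g) := by
    refine ⟨hdm.aestronglyMeasurable, ?_⟩
    rw [hasFiniteIntegral_iff_ofReal (.of_forall hd0), ← hbarron]
    exact hle.trans_lt hf
  set B := ∫ ξ, barronDensity g ξ with hBdef
  have hBnorm : barronNorm 1 f = ENNReal.ofReal B := by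
    rw [hbarron, ofReal_integral_eq_lintegral_ofReal hgi (.of_forall hd0)]
  have hB0 : 0 ≤ B := integral_nonneg hd0
  -- If `B` were 0, then `g` would vanish almost everywhere, so 𝓕 f and then `f` would be zero.
  have hB : 0 < B := by
    refine lt_of_le_of_ne hB0 fun h => hf0 ?_
    have hz := (integral_eq_zero_iff_of_nonneg hd0 hgi).1 h.symm
    have hgz : g =ᵐ[volume] 0 := by
      filter_upwards [hz] with ξ hξ
      exact norm_le_zero_iff.1 ((norm_le_barronDensity g ξ).trans_eq hξ)
    have hF : 𝓕 f = 0 := by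
      ext φ
      rw [((hg.congr hgz).2 φ).2]
      simp
    rw [← FourierTransform.fourierInv_fourier_eq (F := 𝓢'(E d, ℂ)) f, hF]
    exact FourierTransform.fourierInv_zero
  have hint := integrable_of_barronDensity hgm hgi
  have hinv := isGivenBy_fourierInv f hg hint
  have hu : 𝓕⁻ g = fun x => (spectralFun g x : ℂ) := by
    ext x
    rw [← re_fourierInv hgm hint]
    exact Complex.ext (by simp)
      (by simpa using hinv.im_eq_zero hreal (continuous_fourierInv hint) x)
  refine ⟨spectralFun g, hu ▸ hinv, ?_⟩
  have hC : 1 ≤ C₂ Ω := le_max_left _ _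
  obtain ⟨x₀, hx₀⟩ : ∃ x₀, Ω ⊆ Metric.closedBall x₀ (C₂ Ω) := by
    rcases Ω.eq_empty_or_nonempty with rfl | ⟨x₀, hx₀⟩
    · exact ⟨0, Set.empty_subset _⟩
    · exact ⟨x₀, fun x hx => (Metric.dist_le_diam_of_mem hΩ.isBounded hx hx₀).trans
        (le_max_right _ _)⟩
  obtain ⟨L, F, hF, hL, hFerr⟩ := exists_isReLUNetwork_h1Norm_le hgm hB hgi rfl
    (Λ := (logBarronNorm 1 f).toReal) ENNReal.toReal_nonneg
    (by rw [← hlogb, ENNReal.ofReal_toReal hf.ne]) hm hΩ.measurableSet hC hx₀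
  have hBr : (barronNorm 1 f).toReal = B := by rw [hBnorm, ENNReal.toReal_ofReal hB0]
  rw [hBr]
  refine ⟨L, F, hF, hL.trans ?_, hFerr.trans ?_⟩
  · have := three_halves_le_logb hC
    have hΛ : 0 ≤ (logBarronNorm 1 f).toReal := ENNReal.toReal_nonneg
    -- The construction needs no linear factor `C₂ Ω`, neither in the depth nor in the error; it is
    -- inserted using `C₂ Ω ≥ 1`.
    gcongr ?_ * _ * _
    exact le_mul_of_one_le_right (by positivity) hC
  · rw [one_div, ENNReal.rpow_inv_le_iff two_pos, ENNReal.ofReal_rpow_of_nonneg (by positivity)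
      zero_le_two, ← ENNReal.ofReal_toReal (a := volume Ω) hΩ.measure_lt_top.ne,
      ← ENNReal.ofReal_mul (by positivity)]
    refine ENNReal.ofReal_le_ofReal ?_
    have hV : 0 ≤ (volume Ω).toReal := ENNReal.toReal_nonneg
    rw [ENNReal.toReal_ofReal hV, Real.rpow_two]
    simp only [mul_pow, div_pow, Real.sq_sqrt hV, Real.sq_sqrt (Nat.cast_nonneg (α := ℝ) m)]
    calc _ = 4 ^ 2 * (Real.pi ^ 2) ^ 2 / m * 1 * (volume Ω).toReal * B ^ 2 := by ring
      _ ≤ _ := by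
        gcongr
        exact one_le_pow₀ hC
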